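/- Let $(M,g_M)$ be a smooth Riemannian manifold of finite dimension $n\ge 0$, without boundary (oriented or not), let $\varphi\colon M\to(0,+\infty)$ be a smooth function and $I\subseteq\mathbb{R}$ an interval. Let $N=M\times I$ carry the warped product metric $g=g_M+\varphi\,dr^2$, where $r$ is the coordinate of $\mathbb{R}$, and let $\mathcal{G}_t(x,r)=(x,r+t)$, a one-parameter family with generating Killing vector field $K=\frac{d}{dt}\big|_{t=0}\mathcal{G}_t=\partial_r$. An immersion $F\colon \Omega\to N$ of a manifold $\Omega$ of dimension $n$ is called a $\mathcal{G}$-soliton if $$H=g(K,\nu)$$ for its unit normals $\nu$, where $H=g(\vec H,\nu)$ and $\vec H=\sum_{i=1}^n(\nabla_{e_i}e_i)^{\perp}$ is the (unnormalised) mean curvature vector of $F$, $(e_i)$ being a local orthonormal frame along $F$ and $\nabla$ the Levi-Civita connection of $g$. (The equation does not depend on the choice of the sign of $\nu$.) Let $\Omega\subseteq M$ be open and let $u\colon\Omega\to I$ be smooth. Then the graph $\Omega\to N$, $x\mapsto(x,u(x))$, is a $\mathcal{G}$-soliton if and only if $$\mathrm{div}\left(\frac{\nabla u}{W}\right)=\frac{1}{W}-\frac{1}{2W\varphi}\,g_M(\nabla\varphi,\nabla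 u)\quad\text{on }\Omega,\qquad W=\sqrt{g_M(\nabla u,\nabla u)+\frac1\varphi},$$ where the gradient $\nabla$ and the divergence are those of $(M,g_M)$. -/

import Mathlib

open scoped Manifold ContDiff Topology

noncomputable section

namespace KillingGraph

section Riemannian

/-! Riemannian geometry in the preferred charts of a manifold without boundary.
The tangent space at `x` is identified with the model vector space `E` by the preferred chart at
`x`; this is the way the tangent space is set up in Mathlib. -/

variable {E : Type*} [NormedAddCommGroup E] [NormedSpace ℝ E]
  {H : Type*} [TopologicalSpace H] {I : ModelWithCorners ℝ E H}
  {M : Type*} [TopologicalSpace M] [ChartedSpace H M]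

instance [FiniteDimensional ℝ E] (x : M) : FiniteDimensional ℝ (TangentSpace I x) :=
  inferInstanceAs (FiniteDimensional ℝ E)

/-- The inner product `g_x`, with `T_x M` regarded as the model space `E`. -/
def modelInner (g : Bundle.RiemannianMetric (fun x : M => TangentSpace I x)) (x : M) :
    E →L[ℝ] E →L[ℝ] ℝ :=
  g.inner x

/-- The inner product `g_x` as a bilinear form on `T_x M`. -/
def bilinForm (g : Bundle.RiemannianMetric (fun x : M => TangentSpace I x)) (x : M) :
    LinearMap.BilinForm ℝ (TangentSpace I x) :=
  (g.inner x).toBilinForm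

theorem bilinForm_apply (g : Bundle.RiemannianMetric (fun x : M => TangentSpace I x)) (x : M)
    (v w : TangentSpace I x) : bilinForm g x v w = g.inner x v w := rfl

theorem bilinForm_nondegenerate (g : Bundle.RiemannianMetric (fun x : M => TangentSpace I x))
    (x : M) : (bilinForm g x).Nondegenerate := by
  constructor
  · intro v hv
    by_contra h
    exact (g.pos x v h).ne' (hv v)
  · intro v hv
    by_contra h
    exact (g.pos x v h).ne' (hv v)

/-- The expression of the metric in the preferred chart at `x`: the pull-back of `g` under the
inverse of the chart, as a function on the model space `E` (the matrix `g_ij`). -/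
def chartMetric (g : Bundle.RiemannianMetric (fun x : M => TangentSpace I x)) (x : M) (z : E) :
    E →L[ℝ] E →L[ℝ] ℝ :=
  (modelInner g ((extChartAt I x).symm z)).bilinearComp
    (mfderiv 𝓘(ℝ, E) I (extChartAt I x).symm z : E →L[ℝ] E)
    (mfderiv 𝓘(ℝ, E) I (extChartAt I x).symm z : E →L[ℝ] E)

/-- The derivative `∂_a g_bc` at `x` of the metric expressed in the preferred chart at `x`,
as a function of `a`, `b`, `c`. -/
def chartMetricDeriv (g : Bundle.RiemannianMetric (fun x : M => TangentSpace I x)) (x : M) :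
    E →L[ℝ] E →L[ℝ] E →L[ℝ] ℝ :=
  fderiv ℝ (chartMetric g x) (extChartAt I x x)

/-- The Christoffel symbols of the first kind at `x` in the preferred chart at `x`:
`Γ_{c,ab} = (∂_a g_bc + ∂_b g_ac - ∂_c g_ab) / 2`. -/
def christoffelFirst (g : Bundle.RiemannianMetric (fun x : M => TangentSpace I x)) (x : M)
    (a b : TangentSpace I x) : Module.Dual ℝ (TangentSpace I x) where
  toFun c := (chartMetricDeriv g x a b c + chartMetricDeriv g x b a c
    - chartMetricDeriv g x c a b) / 2
  map_add' c d := by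
    have h1 := (chartMetricDeriv g x a b).map_add c d
    have h2 := (chartMetricDeriv g x b a).map_add c d
    have h3 : chartMetricDeriv g x (c + d) a b =
        chartMetricDeriv g x c a b + chartMetricDeriv g x d a b :=
      congrArg (fun f => f a b) ((chartMetricDeriv g x).map_add c d)
    refine (congrArg₂ (fun p q => (p - q) / 2) (congrArg₂ (· + ·) h1 h2) h3).trans ?_
    ring
  map_smul' r c := by
    have h1 := (chartMetricDeriv g x a b).map_smul r c
    have h2 := (chartMetricDeriv g x b a).map_smul r c
    have h3 : chartMetricDeriv g x (r • c) a b = r • chartMetricDeriv g x c a b :=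
      congrArg (fun f => f a b) ((chartMetricDeriv g x).map_smul r c)
    refine (congrArg₂ (fun p q => (p - q) / 2) (congrArg₂ (· + ·) h1 h2) h3).trans ?_
    simp only [smul_eq_mul, RingHom.id_apply]
    ring

theorem christoffelFirst_apply (g : Bundle.RiemannianMetric (fun x : M => TangentSpace I x))
    (x : M) (a b c : TangentSpace I x) :
    christoffelFirst g x a b c = (chartMetricDeriv g x a b c + chartMetricDeriv g x b a c
      - chartMetricDeriv g x c a b) / 2 := rfl

theorem chartMetricDeriv_linear
    (g : Bundle.RiemannianMetric (fun x : M => TangentSpace I x)) (x : M) (r : ℝ) (a a' b c : E) :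
    chartMetricDeriv g x (r • a + a') b c
        = r * chartMetricDeriv g x a b c + chartMetricDeriv g x a' b c ∧
      chartMetricDeriv g x b (r • a + a') c
        = r * chartMetricDeriv g x b a c + chartMetricDeriv g x b a' c ∧
      chartMetricDeriv g x b c (r • a + a')
        = r * chartMetricDeriv g x b c a + chartMetricDeriv g x b c a' := by
  refine ⟨?_, ?_, ?_⟩ <;> simp

theorem christoffelFirst_linear_left
    (g : Bundle.RiemannianMetric (fun x : M => TangentSpace I x)) (x : M) (r : ℝ)
    (a a' b : TangentSpace I x) :
    christoffelFirst g x (r • a + a') b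
      = r • christoffelFirst g x a b + christoffelFirst g x a' b := by
  refine LinearMap.ext fun c => ?_
  have h1 := (chartMetricDeriv_linear g x r a a' b c).1
  have h2 := (chartMetricDeriv_linear g x r a a' b c).2.1
  have h3 := (chartMetricDeriv_linear g x r a a' c b).2.1
  refine (congrArg₂ (fun p q => (p - q) / 2) (congrArg₂ (· + ·) h1 h2) h3).trans ?_
  simp only [LinearMap.add_apply, LinearMap.smul_apply, christoffelFirst_apply, smul_eq_mul]
  ring

theorem christoffelFirst_linear_right
    (g : Bundle.RiemannianMetric (fun x : M => TangentSpace I x)) (x : M) (r : ℝ)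
    (a b b' : TangentSpace I x) :
    christoffelFirst g x a (r • b + b')
      = r • christoffelFirst g x a b + christoffelFirst g x a b' := by
  refine LinearMap.ext fun c => ?_
  have h1 := (chartMetricDeriv_linear g x r b b' a c).2.1
  have h2 := (chartMetricDeriv_linear g x r b b' a c).1
  have h3 := (chartMetricDeriv_linear g x r b b' c a).2.2
  refine (congrArg₂ (fun p q => (p - q) / 2) (congrArg₂ (· + ·) h1 h2) h3).trans ?_
  simp only [LinearMap.add_apply, LinearMap.smul_apply, christoffelFirst_apply, smul_eq_mul]
  ring

variable [FiniteDimensional ℝ E]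

/-- The musical isomorphism `T_x^* M → T_x M`: the vector `sharp g x ℓ` represents the covector `ℓ`
with respect to `g_x`. -/
def sharp (g : Bundle.RiemannianMetric (fun x : M => TangentSpace I x)) (x : M) :
    Module.Dual ℝ (TangentSpace I x) →ₗ[ℝ] TangentSpace I x :=
  ((bilinForm g x).toDual (bilinForm_nondegenerate g x)).symm.toLinearMap

theorem inner_sharp (g : Bundle.RiemannianMetric (fun x : M => TangentSpace I x)) (x : M)
    (l : Module.Dual ℝ (TangentSpace I x)) (w : TangentSpace I x) :
    g.inner x (sharp g x l) w = l w :=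
  LinearMap.BilinForm.apply_toDual_symm_apply (hB := bilinForm_nondegenerate g x) l w

/-- The gradient `∇u` of a function with respect to `g`: `g(∇u, w) = du(w)`. -/
def gradient (g : Bundle.RiemannianMetric (fun x : M => TangentSpace I x)) (u : M → ℝ) (x : M) :
    TangentSpace I x :=
  sharp g x (mfderiv I 𝓘(ℝ, ℝ) u x : TangentSpace I x →L[ℝ] ℝ).toLinearMap

/-- The Christoffel symbols (of the second kind) of the Levi-Civita connection of `g` at `x`, in the
preferred chart at `x`, as a bilinear map `(a, b) ↦ Γ(a, b)`. -/
def christoffel (g : Bundle.RiemannianMetric (fun x : M => TangentSpace I x)) (x : M) :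
    TangentSpace I x →ₗ[ℝ] TangentSpace I x →ₗ[ℝ] TangentSpace I x :=
  LinearMap.mk₂ ℝ (fun a b => sharp g x (christoffelFirst g x a b))
    (fun a a' b => by
      have h := christoffelFirst_linear_left g x 1 a a' b
      rw [one_smul, one_smul] at h
      rw [h, map_add])
    (fun r a b => by
      have h0 := christoffelFirst_linear_left g x 1 0 0 b
      have h := christoffelFirst_linear_left g x r a 0 b
      simp only [one_smul, add_zero, left_eq_add] at h0
      rw [add_zero, h0, add_zero] at h
      rw [h, map_smul])
    (fun a b b' => by
      have h := christoffelFirst_linear_right g x 1 a b b'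
      rw [one_smul, one_smul] at h
      rw [h, map_add])
    (fun r a b => by
      have h0 := christoffelFirst_linear_right g x 1 a 0 0
      have h := christoffelFirst_linear_right g x r a b 0
      simp only [one_smul, add_zero, left_eq_add] at h0
      rw [add_zero, h0, add_zero] at h
      rw [h, map_smul])

/-- The covariant derivative `v ↦ ∇_v X` at `x` of a vector field `X` for the Levi-Civita connection
of `g`: in the preferred chart at `x` it is `D_v X + Γ(v, X)`. -/
def covDeriv (g : Bundle.RiemannianMetric (fun x : M => TangentSpace I x))
    (X : (y : M) → TangentSpace I y) (x : M) : TangentSpace I x →ₗ[ℝ] TangentSpace I x :=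
  letI D : TangentSpace I x →L[ℝ] TangentSpace I x :=
    fderiv ℝ (fun z : E => (VectorField.mpullback 𝓘(ℝ, E) I (extChartAt I x).symm X z : E))
      (extChartAt I x x)
  D.toLinearMap + (christoffel g x).flip (X x)

/-- The divergence `div X = tr (v ↦ ∇_v X)` of a vector field. -/
def divergence (g : Bundle.RiemannianMetric (fun x : M => TangentSpace I x))
    (X : (y : M) → TangentSpace I y) (x : M) : ℝ :=
  LinearMap.trace ℝ (TangentSpace I x) (covDeriv g X x)

end Riemannian

section Immersion

/-! Extrinsic geometry of an immersion `F : S → N` into a Riemannian manifold `(N, g)`. -/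

variable {E : Type*} [NormedAddCommGroup E] [NormedSpace ℝ E] [FiniteDimensional ℝ E]
  {H : Type*} [TopologicalSpace H] {I : ModelWithCorners ℝ E H}
  {S : Type*} [TopologicalSpace S] [ChartedSpace H S]
  {E' : Type*} [NormedAddCommGroup E'] [NormedSpace ℝ E'] [FiniteDimensional ℝ E']
  {H' : Type*} [TopologicalSpace H'] {J : ModelWithCorners ℝ E' H'}
  {N : Type*} [TopologicalSpace N] [ChartedSpace H' N]

variable (I) in
/-- The vectors `F_* e_i` at `x`, where `(e_i)` is a fixed basis of `T_x S`. -/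
def pushBasis (J : ModelWithCorners ℝ E' H') (F : S → N) (x : S)
    (i : Fin (Module.finrank ℝ E)) : TangentSpace J (F x) :=
  mfderiv I J F x (Module.finBasis ℝ E i : E)

variable (I) in
/-- The matrix `γ_ij = g(F_* e_i, F_* e_j)` of the induced metric at `x`. -/
def inducedMatrix (g : Bundle.RiemannianMetric (fun p : N => TangentSpace J p)) (F : S → N) (x : S) :
    Matrix (Fin (Module.finrank ℝ E)) (Fin (Module.finrank ℝ E)) ℝ :=
  Matrix.of fun i j => g.inner (F x) (pushBasis I J F x i) (pushBasis I J F x j)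

variable (I) in
/-- The `g`-orthogonal projection `w ↦ w^⊥` of `T_{F x} N` to the normal space of `F` at `x`. -/
def normalPart (g : Bundle.RiemannianMetric (fun p : N => TangentSpace J p)) (F : S → N) (x : S)
    (w : TangentSpace J (F x)) : TangentSpace J (F x) :=
  w - ∑ i, ∑ j, ((inducedMatrix I g F x)⁻¹ i j * g.inner (F x) w (pushBasis I J F x i)) •
    pushBasis I J F x j

variable (I) in
/-- The covariant derivative `∇_{F_* v} (F_* w)` at `x` along `F`, where `w` is extended to a vector
field with constant coefficients in the preferred chart at `x`:
in charts it is `D²F(v, w) + Γ(DF v, DF w)`. -/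
def covDerivAlong (g : Bundle.RiemannianMetric (fun p : N => TangentSpace J p)) (F : S → N) (x : S)
    (v w : TangentSpace I x) : TangentSpace J (F x) :=
  letI D₂ : TangentSpace J (F x) :=
    fderiv ℝ (fderiv ℝ (writtenInExtChartAt I J x F)) (extChartAt I x x) v w
  D₂ + christoffel g (F x) (mfderiv I J F x v) (mfderiv I J F x w)

variable (I) in
/-- The mean curvature vector of `F` at `x`: the trace, with respect to the induced metric, of the
second fundamental form `(v, w) ↦ (∇_{F_* v} F_* w)^⊥`. -/
def meanCurvatureVector (g : Bundle.RiemannianMetric (fun p : N => TangentSpace J p)) (F : S → N)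
    (x : S) : TangentSpace J (F x) :=
  ∑ i, ∑ j, (inducedMatrix I g F x)⁻¹ i j •
    normalPart I g F x (covDerivAlong I g F x (Module.finBasis ℝ E i : E)
      (Module.finBasis ℝ E j : E))

variable (I) in
/-- `ν` is a unit normal vector of `F` at `x`. -/
def IsUnitNormal (g : Bundle.RiemannianMetric (fun p : N => TangentSpace J p)) (F : S → N)
    (x : S) (ν : TangentSpace J (F x)) : Prop :=
  g.inner (F x) ν ν = 1 ∧ ∀ v : TangentSpace I x, g.inner (F x) (mfderiv I J F x v) ν = 0

/-- The vector field `K(p) = d/dt G_t(p)` at `t = 0` of a one-parameter family of maps with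
`G_0 = id`. -/
def generator (J : ModelWithCorners ℝ E' H') (G : ℝ → N → N) (p : N) : TangentSpace J p :=
  (mfderiv 𝓘(ℝ, ℝ) J (fun t => G t p) 0 (1 : ℝ) : E')

variable (I) in
/-- The restriction of `F` to the open set `Ω` is a `G`-soliton in the region `D` of `N`: it is a
smooth immersion into `D` whose mean curvature `H = g(H⃗, ν)` satisfies `H = g(K, ν)` for the unit
normals `ν`, where `K` is the field that generates `G`. (Both sides change sign with `ν`.) -/
structure IsSoliton (g : Bundle.RiemannianMetric (fun p : N => TangentSpace J p)) (G : ℝ → N → N)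
    (D : Set N) (F : S → N) (Ω : Set S) : Prop where
  mapsTo : Set.MapsTo F Ω D
  smooth : ContMDiffOn I J ∞ F Ω
  immersion : ∀ x ∈ Ω, Function.Injective (mfderiv I J F x)
  equation : ∀ x ∈ Ω, ∀ ν : TangentSpace J (F x), IsUnitNormal I g F x ν →
    g.inner (F x) (meanCurvatureVector I g F x) ν = g.inner (F x) (generator J G (F x)) ν

end Immersion

section Warped

variable {E : Type*} [NormedAddCommGroup E] [NormedSpace ℝ E]
  {M : Type*} [TopologicalSpace M] [ChartedSpace E M]

/-- The warped product metric `g + φ dr²` on `M × ℝ`. For an interval `I ⊆ ℝ`, the warped product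
`M ×_φ I` is the region `M × I` of `M × ℝ` with this metric. -/
def warpedMetric (g : Bundle.RiemannianMetric (fun x : M => TangentSpace 𝓘(ℝ, E) x))
    (φ : M → ℝ) (hφ : ∀ x, 0 < φ x) :
    Bundle.RiemannianMetric
      (fun p : M × ℝ => TangentSpace (𝓘(ℝ, E).prod 𝓘(ℝ, ℝ)) p) where
  inner p := (((modelInner g p.1).bilinearComp
      (ContinuousLinearMap.fst ℝ E ℝ) (ContinuousLinearMap.fst ℝ E ℝ) +
    φ p.1 • (ContinuousLinearMap.mul ℝ ℝ).bilinearComp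
      (ContinuousLinearMap.snd ℝ E ℝ) (ContinuousLinearMap.snd ℝ E ℝ) :
    (E × ℝ) →L[ℝ] (E × ℝ) →L[ℝ] ℝ))
  symm p v w := by
    obtain ⟨v₁, v₂⟩ := v
    obtain ⟨w₁, w₂⟩ := w
    have h : modelInner g p.1 v₁ w₁ = modelInner g p.1 w₁ v₁ := g.symm p.1 v₁ w₁
    change modelInner g p.1 v₁ w₁ + φ p.1 * (v₂ * w₂) = modelInner g p.1 w₁ v₁ + φ p.1 * (w₂ * v₂)
    rw [h, mul_comm v₂]
  pos p v hv := by
    obtain ⟨v₁, v₂⟩ := v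
    change 0 < modelInner g p.1 v₁ v₁ + φ p.1 * (v₂ * v₂)
    have hp := hφ p.1
    by_cases h1 : v₁ = 0
    · have h2 : v₂ ≠ 0 := fun h2 => hv (Prod.ext h1 h2)
      have h4 : 0 < v₂ * v₂ := mul_self_pos.2 h2
      rw [h1, map_zero]
      simpa using mul_pos hp h4
    · have h3 : 0 < modelInner g p.1 v₁ v₁ := g.pos p.1 v₁ h1
      exact add_pos_of_pos_of_nonneg h3 (mul_nonneg hp.le (mul_self_nonneg v₂))
  continuousAt p := by
    have : Continuous fun v : E × ℝ => modelInner g p.1 v.1 v.1 + φ p.1 * (v.2 * v.2) := by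
      fun_prop
    exact this.continuousAt
  isVonNBounded p := by
    have hp := hφ p.1
    have hg : ∀ v : E, 0 ≤ modelInner g p.1 v v := fun v => by
      by_cases h : v = 0
      · rw [h]; simp
      · exact (g.pos p.1 v h).le
    have hb : Bornology.IsBounded {v : E | modelInner g p.1 v v < 1} :=
      (NormedSpace.isVonNBounded_iff ℝ).1 (g.isVonNBounded p.1)
    have h1 : Bornology.IsBounded ({v : E | modelInner g p.1 v v < 1} ×ˢ
        Metric.closedBall (0 : ℝ) (1 + 1 / φ p.1)) := hb.prod Metric.isBounded_closedBall
    refine (NormedSpace.isVonNBounded_iff ℝ (E := E × ℝ)).2 (h1.subset ?_)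
    intro v hv
    change modelInner g p.1 v.1 v.1 + φ p.1 * (v.2 * v.2) < 1 at hv
    have hs := mul_self_nonneg v.2
    refine ⟨?_, ?_⟩
    · change modelInner g p.1 v.1 v.1 < 1
      nlinarith [mul_nonneg hp.le hs]
    · rw [mem_closedBall_zero_iff, Real.norm_eq_abs]
      have h2 : v.2 * v.2 < 1 / φ p.1 := by
        rw [lt_div_iff₀ hp]
        nlinarith [hg v.1]
      nlinarith [abs_mul_abs_self v.2, abs_nonneg v.2, sq_nonneg (|v.2| - 1)]

/-- The region `M × I` of `M × ℝ`. -/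
def cylinder (M : Type*) (I : Set ℝ) : Set (M × ℝ) := Set.univ ×ˢ I

/-- The translations `G_t(x, r) = (x, r + t)`. -/
def translation (t : ℝ) (p : M × ℝ) : M × ℝ := (p.1, p.2 + t)

/-- The graph map `x ↦ (x, u(x))`. -/
def graphMap (u : M → ℝ) (x : M) : M × ℝ := (x, u x)

variable [FiniteDimensional ℝ E]

/-- The function `W = √(g(∇u, ∇u) + 1/φ)`. -/
def slopeFactor (g : Bundle.RiemannianMetric (fun x : M => TangentSpace 𝓘(ℝ, E) x))
    (φ u : M → ℝ) (x : M) : ℝ :=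
  Real.sqrt (g.inner x (gradient g u x) (gradient g u x) + 1 / φ x)

end Warped

end KillingGraph

end

/-!
At a point `x`, let `X = ∇u`, `f = φ(x)` and `W² = |X|² + 1 / f`. The unit normals of the graph are
`ν = (-f ν₂ X, ν₂)` with `f² ν₂² W² = 1` (`isUnitNormal_graphMap_iff`), and the translation field is
`K = (0, 1)`, so that `g(K, ν) = f ν₂`.

In the preferred charts the graph map is `z ↦ (z, u(z))`. Its second derivative is `(0, D²u)`, and
the Christoffel symbols of `g + φ dr²` are those of `g` and terms in `dφ`. Against `ν`, the Hessian
of `u` appears, and `g(∇_v F_* w, ν) = f ν₂ B(v, w)` with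
`B(v, w) = Hess u(v, w) + (dφ(v) du(w) + dφ(w) du(v)) / (2 f) + dφ(X) du(v) du(w) / 2`
(`inner_covDerivAlong_graphMap`). The induced metric is `g + f du ⊗ du`, a rank one perturbation of
`g`, and the trace of `B` with respect to it is
`Δu - Hess u(X, X) / W² + dφ(X) / (2 f² W²) + dφ(X) / (2 f)` (`trace_graph_second_form`).

On the other side, `d(W²)(X) = 2 Hess u(X, X) - dφ(X) / f²` by metric compatibility, whence
`W div(∇u / W) = Δu - Hess u(X, X) / W² + dφ(X) / (2 f² W²)`
(`divergence_gradient_div_slopeFactor`). Hence the mean curvature in the direction `ν` is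
`f ν₂ (W div(∇u / W) + dφ(X) / (2 f))`, and it equals `f ν₂` exactly when the stated equation
holds at `x`.

Tangent vectors are handled as vectors of the model space; the definitions whose names begin with
`model` are the given notions with `T_x M` replaced by the model space.
-/

noncomputable section

namespace KillingGraph

/-! ### Traces with respect to a perturbed inner product -/

section LinearAlgebra

variable {V : Type*} [AddCommGroup V] [Module ℝ V]

/-- The trace of the bilinear form `γ (T ·) ·` with respect to an inner product `γ`, computed with
the inverse Gram matrix of an arbitrary basis, is the trace of `T`. -/
theorem sum_inv_gram_mul_eq_trace {n : ℕ} (b : Module.Basis (Fin n) ℝ V)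
    (γ : LinearMap.BilinForm ℝ V) (hs : ∀ v w, γ v w = γ w v) (hpos : ∀ v, v ≠ 0 → 0 < γ v v)
    (T : V →ₗ[ℝ] V) :
    ∑ i, ∑ j, (Matrix.of fun i j => γ (b i) (b j))⁻¹ i j * γ (T (b i)) (b j) =
      LinearMap.trace ℝ V T := by
  set A : Matrix (Fin n) (Fin n) ℝ := Matrix.of fun i j => γ (b i) (b j) with hA
  have hnd : γ.Nondegenerate := by
    constructor
    · intro v hv
      by_contra h
      exact (hpos v h).ne' (hv v)
    · intro v hv
      by_contra h
      exact (hpos v h).ne' (hv v)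
  have hdet : IsUnit A.det := by
    have h := (LinearMap.BilinForm.nondegenerate_iff_det_ne_zero b).1 hnd
    have e : LinearMap.BilinForm.toMatrix b γ = A := by
      ext i j
      simp [hA, LinearMap.BilinForm.toMatrix_apply]
    rw [e] at h
    exact isUnit_iff_ne_zero.2 h
  have hAt : A.transpose = A := by
    ext i j
    exact hs _ _
  have hAi : ∀ i j, A⁻¹ i j = A⁻¹ j i := fun i j => by
    have h := Matrix.transpose_nonsing_inv A
    rw [hAt] at h
    exact congrFun (congrFun h j) i
  have hT : ∀ i j, γ (T (b i)) (b j) = ∑ k, LinearMap.toMatrix b b T k i * A k j := fun i j => by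
    have h := congrArg (fun v => γ v (b j)) (b.sum_repr (T (b i))).symm
    simpa only [map_sum, map_smul, LinearMap.sum_apply, LinearMap.smul_apply, smul_eq_mul,
      LinearMap.toMatrix_apply, hA, Matrix.of_apply] using h
  have hmul := Matrix.mul_nonsing_inv A hdet
  rw [LinearMap.trace_eq_matrix_trace ℝ b, Matrix.trace]
  refine Finset.sum_congr rfl fun i _ => ?_
  have h1 : ∀ k, ∑ j, A k j * A⁻¹ j i = if k = i then 1 else 0 := fun k => by
    have h := congrFun (congrFun hmul k) i
    rwa [Matrix.mul_apply, Matrix.one_apply] at h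
  calc ∑ j, A⁻¹ i j * γ (T (b i)) (b j)
      = ∑ j, ∑ k, LinearMap.toMatrix b b T k i * (A k j * A⁻¹ j i) := by
        refine Finset.sum_congr rfl fun j _ => ?_
        rw [hT, Finset.mul_sum, hAi i j]
        exact Finset.sum_congr rfl fun k _ => by ring
    _ = ∑ k, LinearMap.toMatrix b b T k i * ∑ j, A k j * A⁻¹ j i := by
        rw [Finset.sum_comm]
        exact Finset.sum_congr rfl fun k _ => by rw [Finset.mul_sum]
    _ = _ := by simp [h1]

variable [FiniteDimensional ℝ V]

/-- The trace behind the mean curvature of a graph. With `W² = G(X, X) + 1 / f`, the trace of the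
form `G(L v, w) + (df(v) du(w) + df(w) du(v)) / (2 f) + df(X) du(v) du(w) / 2` with respect to the
induced metric `G + f du ⊗ du` is expressed by the trace of `L`; here `X` represents `du` and `Y`
represents `df`. -/
theorem trace_graph_second_form {n : ℕ} (b : Module.Basis (Fin n) ℝ V)
    (G : LinearMap.BilinForm ℝ V) (hs : ∀ v w, G v w = G w v) (hpos : ∀ v, v ≠ 0 → 0 < G v v)
    (f : ℝ) (hf : 0 < f) (du df : V →ₗ[ℝ] ℝ) (X Y : V) (hX : ∀ w, G X w = du w)
    (hY : ∀ w, G Y w = df w) (L : V →ₗ[ℝ] V) :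
    ∑ i, ∑ j, (Matrix.of fun i j => G (b i) (b j) + f * (du (b i) * du (b j)))⁻¹ i j *
        (G (L (b i)) (b j) + (df (b i) * du (b j) + df (b j) * du (b i)) / (2 * f) +
          df X * (du (b i) * du (b j)) / 2) =
      LinearMap.trace ℝ V L - G (L X) X / (G X X + 1 / f) +
        df X / (2 * f ^ 2 * (G X X + 1 / f)) + df X / (2 * f) := by
  have hXX : 0 ≤ G X X := by
    by_cases h : X = 0
    · simp [h]
    · exact (hpos X h).le
  have hW : 0 < G X X + 1 / f := by positivity
  set s := G X X with hsdef
  have hduX : du X = s := (hX X).symm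
  have hduY : du Y = df X := by rw [← hX, hs, hY]
  -- the form whose trace is taken is `G (S ·) ·`
  let S : V →ₗ[ℝ] V := L + ((1 / (2 * f)) • (df.smulRight X + du.smulRight Y) +
    (df X / 2) • du.smulRight X)
  have hS : ∀ v, S v = L v + ((1 / (2 * f)) • (df v • X + du v • Y) + (df X / 2) • du v • X) :=
    fun v => rfl
  -- the metric `γ = G + f du ⊗ du` is `G (· + f du(·) X) ·`, and the inverse of
  -- `v ↦ v + f du(v) X` is `v ↦ v - (du(v) / W²) X`; thus `γ (T ·) · = G (S ·) ·`
  let T : V →ₗ[ℝ] V := S - (1 / (s + 1 / f)) • (du ∘ₗ S).smulRight X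
  have hT : ∀ v, T v = S v - (1 / (s + 1 / f)) • du (S v) • X := fun v => rfl
  let γ : LinearMap.BilinForm ℝ V :=
    G + f • LinearMap.mk₂ ℝ (fun v w => du v * du w) (fun _ _ _ => by simp [add_mul])
      (fun _ _ _ => by simp [mul_assoc]) (fun _ _ _ => by simp [mul_add])
      (fun _ _ _ => by simp; ring)
  have hγ : ∀ v w, γ v w = G v w + f * (du v * du w) := fun v w => rfl
  have key := sum_inv_gram_mul_eq_trace b γ (fun v w => by rw [hγ, hγ, hs v w, mul_comm (du v)])
    (fun v hv => by
      rw [hγ]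
      have := hpos v hv
      have := mul_nonneg hf.le (mul_self_nonneg (du v))
      linarith) T
  have hγT : ∀ v w, γ (T v) w = G (L v) w + (df v * du w + df w * du v) / (2 * f) +
      df X * (du v * du w) / 2 := fun v w => by
    have h1 : γ (T v) w = G (S v) w := by
      rw [hγ, hT]
      simp only [map_sub, map_smul, LinearMap.sub_apply, LinearMap.smul_apply, smul_eq_mul, hX,
        hduX]
      field_simp
      ring
    rw [h1, hS]
    simp only [map_add, map_smul, LinearMap.add_apply, LinearMap.smul_apply, smul_eq_mul, hX, hY]
    field_simp
    ring
  simp only [hγT, hγ] at key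
  rw [key]
  have htr : LinearMap.trace ℝ V T = LinearMap.trace ℝ V S - 1 / (s + 1 / f) * du (S X) := by
    simp only [T, map_sub, map_smul, LinearMap.trace_smulRight, smul_eq_mul, LinearMap.comp_apply]
  have htrS : LinearMap.trace ℝ V S = LinearMap.trace ℝ V L +
      (1 / (2 * f) * (df X + df X) + df X / 2 * s) := by
    simp only [S, map_add, map_smul, LinearMap.trace_smulRight, smul_eq_mul, hduY, hduX]
  have hduS : du (S X) =
      G (L X) X + (1 / (2 * f) * (df X * s + s * df X) + df X / 2 * (s * s)) := by
    rw [hS]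
    simp only [map_add, map_smul, smul_eq_mul, hduY, hduX]
    rw [← hX, hs]
  rw [htr, htrS, hduS]
  have hW' : s * f + 1 ≠ 0 := by
    have := mul_nonneg hXX hf.le
    positivity
  field_simp
  ring

end LinearAlgebra

/-! ### The metric in a preferred chart -/

section Charts

variable {E : Type*} [NormedAddCommGroup E] [NormedSpace ℝ E]
  {M : Type*} [TopologicalSpace M] [ChartedSpace E M]

/-- The derivative at `z` of the inverse of the preferred chart at `x`, as an endomorphism of the
model space. -/
def symmDeriv (x : M) (z : E) : E →L[ℝ] E :=
  mfderiv 𝓘(ℝ, E) 𝓘(ℝ, E) (extChartAt 𝓘(ℝ, E) x).symm z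

/-- The differential of a real function at `x`, as a covector on the model space. -/
def modelDeriv (u : M → ℝ) (x : M) : E →L[ℝ] ℝ :=
  mfderiv 𝓘(ℝ, E) 𝓘(ℝ, ℝ) u x

theorem modelDeriv_eq_fderiv {u : M → ℝ} {x : M}
    (hu : MDifferentiableAt 𝓘(ℝ, E) 𝓘(ℝ, ℝ) u x) :
    modelDeriv u x =
      fderiv ℝ (u ∘ (extChartAt 𝓘(ℝ, E) x).symm) (extChartAt 𝓘(ℝ, E) x x) := by
  rw [modelDeriv, hu.mfderiv, modelWithCornersSelf_coe, Set.range_id, fderivWithin_univ]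
  rfl

theorem contDiffAt_comp_symm [IsManifold 𝓘(ℝ, E) ∞ M] {u : M → ℝ} {x : M}
    (hu : ContMDiffAt 𝓘(ℝ, E) 𝓘(ℝ, ℝ) ∞ u x) :
    ContDiffAt ℝ ∞ (u ∘ (extChartAt 𝓘(ℝ, E) x).symm) (extChartAt 𝓘(ℝ, E) x x) := by
  have h := (contMDiffAt_iff.1 hu).2
  rw [modelWithCornersSelf_coe, Set.range_id, contDiffWithinAt_univ] at h
  exact h

variable (g : Bundle.RiemannianMetric (fun x : M => TangentSpace 𝓘(ℝ, E) x))

theorem modelInner_symm (x : M) (v w : E) : modelInner g x v w = modelInner g x w v :=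
  g.symm x v w

theorem modelInner_pos (x : M) {v : E} (hv : v ≠ 0) : 0 < modelInner g x v v :=
  g.pos x v hv

theorem chartMetric_apply (x : M) (z v w : E) :
    chartMetric g x z v w = modelInner g ((extChartAt 𝓘(ℝ, E) x).symm z)
      (symmDeriv x z v)
      (symmDeriv x z w) := rfl

theorem chartMetric_symm (x : M) (z v w : E) :
    chartMetric g x z v w = chartMetric g x z w v :=
  (chartMetric_apply g x z v w).trans
    ((modelInner_symm g _ _ _).trans (chartMetric_apply g x z w v).symm)

variable [IsManifold 𝓘(ℝ, E) 1 M]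

theorem mdifferentiableAt_extChartAt_symm' (x : M) {z : E}
    (hz : z ∈ (extChartAt 𝓘(ℝ, E) x).target) :
    MDifferentiableAt 𝓘(ℝ, E) 𝓘(ℝ, E) (extChartAt 𝓘(ℝ, E) x).symm z := by
  have h := mdifferentiableWithinAt_extChartAt_symm (I := 𝓘(ℝ, E)) hz
  rwa [modelWithCornersSelf_coe, Set.range_id, mdifferentiableWithinAt_univ] at h

theorem isInvertible_symmDeriv (x : M) {z : E}
    (hz : z ∈ (extChartAt 𝓘(ℝ, E) x).target) :
    (symmDeriv x z : E →L[ℝ] E).IsInvertible := by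
  have h := isInvertible_mfderivWithin_extChartAt_symm (I := 𝓘(ℝ, E)) hz
  rw [modelWithCornersSelf_coe, Set.range_id, mfderivWithin_univ] at h
  exact h

theorem symmDeriv_self (x : M) (v : E) :
    symmDeriv x (extChartAt 𝓘(ℝ, E) x x) v
      = v := by
  have h := mfderivWithin_range_extChartAt_symm (I := 𝓘(ℝ, E)) (x := x)
  rw [modelWithCornersSelf_coe, Set.range_id, mfderivWithin_univ] at h
  exact congrArg (fun f : E →L[ℝ] E => f v) h

theorem chartMetric_self (x : M) (v w : E) :
    chartMetric g x (extChartAt 𝓘(ℝ, E) x x) v w = modelInner g x v w := by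
  have h1 := symmDeriv_self x v
  have h2 := symmDeriv_self x w
  have h3 : ∀ y, y = x → modelInner g y v w = modelInner g x v w := fun y h => by rw [h]
  exact (congrArg₂ (fun a b : E =>
    modelInner g ((extChartAt 𝓘(ℝ, E) x).symm (extChartAt 𝓘(ℝ, E) x x)) a b) h1 h2).trans
    (h3 _ (extChartAt_to_inv x))

theorem chartMetric_pos (x : M) {z : E} (hz : z ∈ (extChartAt 𝓘(ℝ, E) x).target) {v : E}
    (hv : v ≠ 0) : 0 < chartMetric g x z v v := by
  refine g.pos _ _ fun h => hv ?_
  exact (isInvertible_symmDeriv x hz).injective (h.trans (map_zero _).symm)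

end Charts

/-! ### Smoothness of the metric in a preferred chart -/

section Smooth

variable {E : Type*} [NormedAddCommGroup E] [NormedSpace ℝ E] [FiniteDimensional ℝ E]
  {M : Type*} [TopologicalSpace M] [ChartedSpace E M] [IsManifold 𝓘(ℝ, E) ∞ M]

/-- The matrix `g_ij` of a smooth metric in a chart is smooth: the inverse of the trivialization of
the tangent bundle is a smooth section of a bundle of linear maps, and `g` is applied to it. -/
theorem contDiffOn_chartMetric
    (g : Bundle.ContMDiffRiemannianMetric 𝓘(ℝ, E) ∞ E (fun x : M => TangentSpace 𝓘(ℝ, E) x))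
    (x : M) :
    ContDiffOn ℝ ∞ (chartMetric g.toRiemannianMetric x) (extChartAt 𝓘(ℝ, E) x).target := by
  have : IsManifold 𝓘(ℝ, E) 1 M := IsManifold.of_le (n := ∞) (by simp)
  set e := trivializationAt E (TangentSpace 𝓘(ℝ, E)) x with he
  have hvec : ∀ v : E, ContMDiffOn 𝓘(ℝ, E) (𝓘(ℝ, E).prod 𝓘(ℝ, E)) ∞
      (fun y => Bundle.TotalSpace.mk' E y (e.symmL ℝ y v)) e.baseSet := fun v y hy =>
    (ContMDiffAt.clm_bundle_apply (F₁ := E) (E₁ := Bundle.Trivial M E)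
      (E₂ := fun y : M => TangentSpace 𝓘(ℝ, E) y) (ϕ := fun y => e.symmL ℝ y)
      (e.contMDiffAt_symmL hy) (v := fun _ => v)
      ((Bundle.contMDiffAt_section y).2 contMDiffAt_const)).contMDiffWithinAt
  have hscal : ∀ v w : E, ContMDiffOn 𝓘(ℝ, E) 𝓘(ℝ, ℝ) ∞
      (fun y => g.inner y (e.symmL ℝ y v) (e.symmL ℝ y w)) e.baseSet := fun v w y hy => by
    have h := ContMDiffWithinAt.clm_bundle_apply₂ (F₁ := E) (F₂ := E) (F₃ := ℝ)
      (E₁ := fun y : M => TangentSpace 𝓘(ℝ, E) y) (E₂ := fun y : M => TangentSpace 𝓘(ℝ, E) y)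
      (E₃ := Bundle.Trivial M ℝ) (b := fun y => y) (ψ := fun y => g.inner y)
      (g.contMDiff y).contMDiffWithinAt (hvec v y hy) (hvec w y hy)
    exact Bundle.contMDiffWithinAt_section.1 h
  have hmaps : Set.MapsTo (extChartAt 𝓘(ℝ, E) x).symm (extChartAt 𝓘(ℝ, E) x).target
      (chartAt E x).source := fun z hz => by
    rw [← extChartAt_source 𝓘(ℝ, E)]
    exact (extChartAt 𝓘(ℝ, E) x).map_target hz
  have hcomp : ∀ v w : E, ContDiffOn ℝ ∞ (fun z => chartMetric g.toRiemannianMetric x z v w)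
      (extChartAt 𝓘(ℝ, E) x).target := fun v w => by
    refine ((hscal v w).comp (contMDiffOn_extChartAt_symm x) hmaps).contDiffOn.congr fun z hz => ?_
    have h := TangentBundle.symmL_trivializationAt (I := 𝓘(ℝ, E)) (hmaps hz)
    rw [modelWithCornersSelf_coe, Set.range_id, mfderivWithin_univ,
      (extChartAt 𝓘(ℝ, E) x).right_inv hz] at h
    have hv : ∀ v : E, (e.symmL ℝ ((extChartAt 𝓘(ℝ, E) x).symm z) : E →L[ℝ] E) v =
      symmDeriv x z v := fun v =>
      congrArg (fun f : E →L[ℝ] E => f v) h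
    exact (congrArg₂ (fun a b : E =>
      modelInner g.toRiemannianMetric ((extChartAt 𝓘(ℝ, E) x).symm z) a b) (hv v) (hv w)).symm
  exact contDiffOn_clm_apply.2 fun v => contDiffOn_clm_apply.2 fun w => hcomp v w

theorem contDiffAt_chartMetric
    (g : Bundle.ContMDiffRiemannianMetric 𝓘(ℝ, E) ∞ E (fun x : M => TangentSpace 𝓘(ℝ, E) x))
    (x : M) :
    ContDiffAt ℝ ∞ (chartMetric g.toRiemannianMetric x) (extChartAt 𝓘(ℝ, E) x x) :=
  (contDiffOn_chartMetric g x).contDiffAt (extChartAt_target_mem_nhds x)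

end Smooth

/-! ### Christoffel symbols -/

section Christoffel

variable {E : Type*} [NormedAddCommGroup E] [NormedSpace ℝ E] [FiniteDimensional ℝ E]
  {H : Type*} [TopologicalSpace H] {I : ModelWithCorners ℝ E H}
  {M : Type*} [TopologicalSpace M] [ChartedSpace H M]
  (g : Bundle.RiemannianMetric (fun x : M => TangentSpace I x))

/-- The Christoffel symbols `Γ(a, b)` at `x`, with `T_x M` regarded as the model space. -/
def modelChristoffel (x : M) (a b : E) : E := christoffel g x a b

theorem modelInner_christoffel (x : M) (a b c : E) :
    modelInner g x (modelChristoffel g x a b) c = (chartMetricDeriv g x a b c +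
      chartMetricDeriv g x b a c - chartMetricDeriv g x c a b) / 2 :=
  inner_sharp g x (christoffelFirst g x a b) c

end Christoffel

/-! ### Vector fields in a preferred chart and metric compatibility -/

section Calculus

variable {E : Type*} [NormedAddCommGroup E] [NormedSpace ℝ E]
  {M : Type*} [TopologicalSpace M] [ChartedSpace E M]

/-- The vector field `X` in the preferred chart at `x`, as a map of the model space. -/
def chartField (X : (y : M) → TangentSpace 𝓘(ℝ, E) y) (x : M) (z : E) : E :=
  VectorField.mpullback 𝓘(ℝ, E) 𝓘(ℝ, E) (extChartAt 𝓘(ℝ, E) x).symm X z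

theorem chartField_smul (f : M → ℝ) (X : (y : M) → TangentSpace 𝓘(ℝ, E) y) (x : M) (z : E) :
    chartField (fun y => f y • X y) x z =
      f ((extChartAt 𝓘(ℝ, E) x).symm z) • chartField X x z :=
  VectorField.mpullback_smul_apply (g := f)

section

variable [IsManifold 𝓘(ℝ, E) 1 M]

theorem symmDeriv_chartField (X : (y : M) → TangentSpace 𝓘(ℝ, E) y) (x : M) {z : E}
    (hz : z ∈ (extChartAt 𝓘(ℝ, E) x).target) :
    symmDeriv x z (chartField X x z) =
      (X ((extChartAt 𝓘(ℝ, E) x).symm z) : E) :=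
  (isInvertible_symmDeriv x hz).self_apply_inverse
    (X ((extChartAt 𝓘(ℝ, E) x).symm z))

theorem chartField_self (X : (y : M) → TangentSpace 𝓘(ℝ, E) y) (x : M) :
    chartField X x (extChartAt 𝓘(ℝ, E) x x) = (X x : E) := by
  have h := symmDeriv_chartField X x (mem_extChartAt_target x)
  have h3 : ∀ y, y = x → (X y : E) = (X x : E) := fun y h => by rw [h]
  exact (symmDeriv_self x _).symm.trans (h.trans (h3 _ (extChartAt_to_inv x)))

theorem fderiv_comp_symm {u : M → ℝ} {x : M} {z : E} (hz : z ∈ (extChartAt 𝓘(ℝ, E) x).target)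
    (hu : MDifferentiableAt 𝓘(ℝ, E) 𝓘(ℝ, ℝ) u ((extChartAt 𝓘(ℝ, E) x).symm z)) (w : E) :
    fderiv ℝ (u ∘ (extChartAt 𝓘(ℝ, E) x).symm) z w =
      modelDeriv u ((extChartAt 𝓘(ℝ, E) x).symm z)
        (symmDeriv x z w) := by
  have h := mfderiv_comp z hu (mdifferentiableAt_extChartAt_symm' x hz)
  rw [mfderiv_eq_fderiv] at h
  exact congrArg (fun f : E →L[ℝ] ℝ => f w) h

end

variable [FiniteDimensional ℝ E]
variable (g : Bundle.RiemannianMetric (fun x : M => TangentSpace 𝓘(ℝ, E) x))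

/-- The gradient of `u` at `x`, as a vector of the model space. -/
def modelGradient (u : M → ℝ) (x : M) : E := gradient g u x

theorem modelInner_gradient (u : M → ℝ) (x : M) (w : E) :
    modelInner g x (modelGradient g u x) w = modelDeriv u x w :=
  inner_sharp g x _ w

/-- The covariant derivative `v ↦ ∇_v X` at `x`, as an endomorphism of the model space. -/
def modelCovDeriv (X : (y : M) → TangentSpace 𝓘(ℝ, E) y) (x : M) : E →ₗ[ℝ] E :=
  covDeriv g X x

theorem divergence_eq_trace (X : (y : M) → TangentSpace 𝓘(ℝ, E) y) (x : M) :
    divergence g X x = LinearMap.trace ℝ E (modelCovDeriv g X x) := rfl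

theorem modelChristoffel_smul (x : M) (v w : E) (c : ℝ) :
    modelChristoffel g x v (c • w) = c • modelChristoffel g x v w :=
  (christoffel g x v).map_smul c w

variable [IsManifold 𝓘(ℝ, E) 1 M]

theorem modelCovDeriv_apply (X : (y : M) → TangentSpace 𝓘(ℝ, E) y) (x : M) (v : E) :
    modelCovDeriv g X x v = fderiv ℝ (chartField X x) (extChartAt 𝓘(ℝ, E) x x) v +
      modelChristoffel g x v (chartField X x (extChartAt 𝓘(ℝ, E) x x)) :=
  congrArg (fun w : E => fderiv ℝ (chartField X x) (extChartAt 𝓘(ℝ, E) x x) v +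
    modelChristoffel g x v w) (chartField_self X x).symm

theorem chartField_gradient_self (u : M → ℝ) (x : M) :
    chartField (gradient g u) x (extChartAt 𝓘(ℝ, E) x x) = modelGradient g u x :=
  chartField_self _ x

/-- In the chart, the gradient still represents the differential, at every point of the chart and
not only at its centre; this is what can be differentiated. -/
theorem chartMetric_chartField_gradient {u : M → ℝ} {x : M} {z : E}
    (hz : z ∈ (extChartAt 𝓘(ℝ, E) x).target)
    (hu : MDifferentiableAt 𝓘(ℝ, E) 𝓘(ℝ, ℝ) u ((extChartAt 𝓘(ℝ, E) x).symm z)) (w : E) :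
    chartMetric g x z (chartField (gradient g u) x z) w =
      fderiv ℝ (u ∘ (extChartAt 𝓘(ℝ, E) x).symm) z w := by
  rw [chartMetric_apply, symmDeriv_chartField _ _ hz, fderiv_comp_symm hz hu]
  exact modelInner_gradient g u _ _

omit [FiniteDimensional ℝ E] [IsManifold 𝓘(ℝ, E) 1 M] in
theorem chartMetricDeriv_symm {x : M}
    (hg : DifferentiableAt ℝ (chartMetric g x) (extChartAt 𝓘(ℝ, E) x x)) (a v w : E) :
    chartMetricDeriv g x a v w = chartMetricDeriv g x a w v := by
  have h : ∀ v w : E, chartMetricDeriv g x a v w =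
      fderiv ℝ (fun z => chartMetric g x z v w) (extChartAt 𝓘(ℝ, E) x x) a := fun v w => by
    rw [fderiv_clm_apply (hg.clm_apply (differentiableAt_const v)) (differentiableAt_const w),
      fderiv_clm_apply hg (differentiableAt_const v)]
    simp [chartMetricDeriv]
  rw [h, h]
  exact congrArg (fun f : E → ℝ => fderiv ℝ f _ a)
    (funext fun z => chartMetric_symm g x z v w)

omit [IsManifold 𝓘(ℝ, E) 1 M] in
/-- The metric is parallel: `∂_v g(a, b) = g(Γ(v, a), b) + g(Γ(v, b), a)`. -/
theorem chartMetricDeriv_eq_inner_christoffel {x : M}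
    (hg : DifferentiableAt ℝ (chartMetric g x) (extChartAt 𝓘(ℝ, E) x x)) (v a b : E) :
    chartMetricDeriv g x v a b =
      modelInner g x (modelChristoffel g x v a) b +
        modelInner g x (modelChristoffel g x v b) a := by
  rw [modelInner_christoffel, modelInner_christoffel, chartMetricDeriv_symm g hg v b a,
    chartMetricDeriv_symm g hg b v a, chartMetricDeriv_symm g hg a v b]
  ring

/-- Metric compatibility: `v g(P, Q) = g(∇_v P, Q) + g(∇_v Q, P)`. -/
theorem fderiv_chartMetric_apply {x : M}
    (hg : DifferentiableAt ℝ (chartMetric g x) (extChartAt 𝓘(ℝ, E) x x)) {P Q : E → E}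
    (hP : DifferentiableAt ℝ P (extChartAt 𝓘(ℝ, E) x x))
    (hQ : DifferentiableAt ℝ Q (extChartAt 𝓘(ℝ, E) x x)) (v : E) :
    fderiv ℝ (fun z => chartMetric g x z (P z) (Q z)) (extChartAt 𝓘(ℝ, E) x x) v =
      modelInner g x (fderiv ℝ P (extChartAt 𝓘(ℝ, E) x x) v +
        modelChristoffel g x v (P (extChartAt 𝓘(ℝ, E) x x))) (Q (extChartAt 𝓘(ℝ, E) x x)) +
      modelInner g x (fderiv ℝ Q (extChartAt 𝓘(ℝ, E) x x) v +
        modelChristoffel g x v (Q (extChartAt 𝓘(ℝ, E) x x))) (P (extChartAt 𝓘(ℝ, E) x x)) := by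
  have h0 : (fderiv ℝ (chartMetric g x) (extChartAt 𝓘(ℝ, E) x x) v) =
    chartMetricDeriv g x v := rfl
  rw [fderiv_clm_apply (hg.clm_apply hP) hQ, fderiv_clm_apply hg hP]
  simp only [add_apply, ContinuousLinearMap.comp_apply,
    ContinuousLinearMap.flip_apply, h0, chartMetric_self]
  rw [chartMetricDeriv_eq_inner_christoffel g hg, map_add, map_add,
    add_apply, add_apply,
    modelInner_symm g x (P _) (fderiv ℝ Q _ v)]
  ring

/-- The gradient of a twice differentiable function is differentiable, since in the chart it is the
inverse of the matrix `g_ij` applied to the differential. -/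
theorem differentiableAt_chartField_gradient {u : M → ℝ} {x : M}
    (hg : DifferentiableAt ℝ (chartMetric g x) (extChartAt 𝓘(ℝ, E) x x))
    (hu : ∀ᶠ y in 𝓝 x, MDifferentiableAt 𝓘(ℝ, E) 𝓘(ℝ, ℝ) u y)
    (hu2 : DifferentiableAt ℝ (fderiv ℝ (u ∘ (extChartAt 𝓘(ℝ, E) x).symm))
      (extChartAt 𝓘(ℝ, E) x x)) :
    DifferentiableAt ℝ (chartField (gradient g u) x) (extChartAt 𝓘(ℝ, E) x x) := by
  have hinv : ∀ z ∈ (extChartAt 𝓘(ℝ, E) x).target, (chartMetric g x z).IsInvertible := by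
    intro z hz
    have hinj : Function.Injective (chartMetric g x z) := by
      rw [injective_iff_map_eq_zero]
      intro v hv
      by_contra h
      have := chartMetric_pos g x hz h
      rw [hv] at this
      exact lt_irrefl _ this
    have hfin : Module.finrank ℝ E = Module.finrank ℝ (E →L[ℝ] ℝ) :=
      (Subspace.dual_finrank_eq (K := ℝ) (V := E)).symm.trans
        (LinearMap.toContinuousLinearMap (𝕜 := ℝ) (E := E) (F' := ℝ)).finrank_eq
    have hsurj : Function.Surjective (chartMetric g x z) :=
      (LinearMap.injective_iff_surjective_of_finrank_eq_finrank hfin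
        (f := (chartMetric g x z).toLinearMap)).1 hinj
    exact ⟨ContinuousLinearEquiv.ofBijective (chartMetric g x z)
      (LinearMap.ker_eq_bot.2 hinj) (LinearMap.range_eq_top.2 hsurj),
      ContinuousLinearEquiv.coe_ofBijective _ _ _⟩
  have hz0 : extChartAt 𝓘(ℝ, E) x x ∈ (extChartAt 𝓘(ℝ, E) x).target := mem_extChartAt_target x
  have hd : DifferentiableAt ℝ (fun z => (chartMetric g x z).inverse
      (fderiv ℝ (u ∘ (extChartAt 𝓘(ℝ, E) x).symm) z)) (extChartAt 𝓘(ℝ, E) x x) := by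
    refine DifferentiableAt.clm_apply ?_ hu2
    exact (((hinv _ hz0).contDiffAt_map_inverse (n := 1)).differentiableAt one_ne_zero).comp _ hg
  refine hd.congr_of_eventuallyEq ?_
  have hcont : Filter.Tendsto (extChartAt 𝓘(ℝ, E) x).symm (𝓝 (extChartAt 𝓘(ℝ, E) x x)) (𝓝 x) := by
    have h := continuousAt_extChartAt_symm (I := 𝓘(ℝ, E)) x
    rwa [ContinuousAt, extChartAt_to_inv] at h
  filter_upwards [extChartAt_target_mem_nhds (I := 𝓘(ℝ, E)) x, hcont.eventually hu] with z hz huz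
  refine ((hinv z hz).inverse_apply_eq.2 ?_).symm
  ext w
  exact (chartMetric_chartField_gradient g hz huz w).symm

end Calculus

/-! ### Hessian and divergence -/

section Divergence

variable {E : Type*} [NormedAddCommGroup E] [NormedSpace ℝ E] [FiniteDimensional ℝ E]
  {M : Type*} [TopologicalSpace M] [ChartedSpace E M] [IsManifold 𝓘(ℝ, E) 1 M]
  (g : Bundle.RiemannianMetric (fun x : M => TangentSpace 𝓘(ℝ, E) x))

omit [FiniteDimensional ℝ E] [IsManifold 𝓘(ℝ, E) 1 M] in
theorem eventually_extChartAt_symm {p : M → Prop} {x : M} (h : ∀ᶠ y in 𝓝 x, p y) :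
    ∀ᶠ z in 𝓝 (extChartAt 𝓘(ℝ, E) x x), p ((extChartAt 𝓘(ℝ, E) x).symm z) := by
  have h1 := continuousAt_extChartAt_symm (I := 𝓘(ℝ, E)) x
  rw [ContinuousAt, extChartAt_to_inv] at h1
  exact h1.eventually h

theorem modelCovDeriv_smul {f : M → ℝ} {X : (y : M) → TangentSpace 𝓘(ℝ, E) y} {x : M}
    (hf : DifferentiableAt ℝ (f ∘ (extChartAt 𝓘(ℝ, E) x).symm) (extChartAt 𝓘(ℝ, E) x x))
    (hX : DifferentiableAt ℝ (chartField X x) (extChartAt 𝓘(ℝ, E) x x)) :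
    modelCovDeriv g (fun y => f y • X y) x = f x • modelCovDeriv g X x +
      (fderiv ℝ (f ∘ (extChartAt 𝓘(ℝ, E) x).symm) (extChartAt 𝓘(ℝ, E) x x)).toLinearMap.smulRight
        (chartField X x (extChartAt 𝓘(ℝ, E) x x)) := by
  have h1 : chartField (fun y => f y • X y) x =
      fun z => (f ∘ (extChartAt 𝓘(ℝ, E) x).symm) z • chartField X x z :=
    funext fun z => chartField_smul f X x z
  have h4 : (f ∘ (extChartAt 𝓘(ℝ, E) x).symm) (extChartAt 𝓘(ℝ, E) x x) = f x := by
    rw [Function.comp_apply, extChartAt_to_inv]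
  ext v
  rw [modelCovDeriv_apply, h1, fderiv_fun_smul hf hX]
  simp only [h4, modelChristoffel_smul, LinearMap.add_apply, LinearMap.smul_apply,
    modelCovDeriv_apply, add_apply, smul_apply, ContinuousLinearMap.smulRight_apply, smul_add,
    LinearMap.smulRight_apply, ContinuousLinearMap.coe_coe]
  abel

theorem divergence_smul {f : M → ℝ} {X : (y : M) → TangentSpace 𝓘(ℝ, E) y} {x : M}
    (hf : DifferentiableAt ℝ (f ∘ (extChartAt 𝓘(ℝ, E) x).symm) (extChartAt 𝓘(ℝ, E) x x))
    (hX : DifferentiableAt ℝ (chartField X x) (extChartAt 𝓘(ℝ, E) x x)) :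
    divergence g (fun y => f y • X y) x = f x * divergence g X x +
      fderiv ℝ (f ∘ (extChartAt 𝓘(ℝ, E) x).symm) (extChartAt 𝓘(ℝ, E) x x)
        (chartField X x (extChartAt 𝓘(ℝ, E) x x)) := by
  rw [divergence_eq_trace, modelCovDeriv_smul g hf hX, map_add, map_smul,
    LinearMap.trace_smulRight]
  rfl

/-- `g(∇_v ∇u, w)` is the Hessian `D²u(v, w) - du(Γ(v, w))`: metric compatibility for `∇u` and a
field with constant coefficients. -/
theorem inner_covDeriv_gradient {u : M → ℝ} {x : M}
    (hg : DifferentiableAt ℝ (chartMetric g x) (extChartAt 𝓘(ℝ, E) x x))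
    (hu : ∀ᶠ y in 𝓝 x, MDifferentiableAt 𝓘(ℝ, E) 𝓘(ℝ, ℝ) u y)
    (hu2 : DifferentiableAt ℝ (fderiv ℝ (u ∘ (extChartAt 𝓘(ℝ, E) x).symm))
      (extChartAt 𝓘(ℝ, E) x x)) (v w : E) :
    modelInner g x (modelCovDeriv g (gradient g u) x v) w =
      fderiv ℝ (fderiv ℝ (u ∘ (extChartAt 𝓘(ℝ, E) x).symm)) (extChartAt 𝓘(ℝ, E) x x) v w -
        modelInner g x (modelChristoffel g x v w) (modelGradient g u x) := by
  have hP := differentiableAt_chartField_gradient g hg hu hu2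
  have h := fderiv_chartMetric_apply g hg hP (differentiableAt_const w) v
  have he : (fun z => chartMetric g x z (chartField (gradient g u) x z) w) =ᶠ[
      𝓝 (extChartAt 𝓘(ℝ, E) x x)] fun z => fderiv ℝ (u ∘ (extChartAt 𝓘(ℝ, E) x).symm) z w := by
    filter_upwards [extChartAt_target_mem_nhds (I := 𝓘(ℝ, E)) x, eventually_extChartAt_symm hu]
      with z hz huz
    exact chartMetric_chartField_gradient g hz huz w
  rw [he.fderiv_eq, fderiv_clm_apply hu2 (differentiableAt_const w)] at h
  simp only [fderiv_fun_const, chartField_gradient_self] at h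
  simp only [Pi.zero_apply, ContinuousLinearMap.comp_zero, zero_add, zero_apply,
    ContinuousLinearMap.flip_apply] at h
  rw [h, modelCovDeriv_apply, chartField_gradient_self]
  ring

omit [FiniteDimensional ℝ E] [IsManifold 𝓘(ℝ, E) 1 M] in
theorem modelInner_self_nonneg (x : M) (v : E) : 0 ≤ modelInner g x v v := by
  by_cases h : v = 0
  · rw [h]; simp
  · exact (modelInner_pos g x h).le

variable {φ : M → ℝ} (hφ : ∀ x, 0 < φ x)

omit [IsManifold 𝓘(ℝ, E) 1 M] in
include hφ in
theorem slopeFactor_sq_pos (u : M → ℝ) (x : M) :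
    0 < modelInner g x (modelGradient g u x) (modelGradient g u x) + 1 / φ x :=
  add_pos_of_nonneg_of_pos (modelInner_self_nonneg g x _) (one_div_pos.2 (hφ x))

omit [IsManifold 𝓘(ℝ, E) 1 M] in
include hφ in
theorem slopeFactor_pos (u : M → ℝ) (x : M) : 0 < slopeFactor g φ u x :=
  Real.sqrt_pos.2 (slopeFactor_sq_pos g hφ u x)

omit [IsManifold 𝓘(ℝ, E) 1 M] in
include hφ in
theorem slopeFactor_sq (u : M → ℝ) (x : M) :
    slopeFactor g φ u x ^ 2 =
      modelInner g x (modelGradient g u x) (modelGradient g u x) + 1 / φ x :=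
  Real.sq_sqrt (slopeFactor_sq_pos g hφ u x).le

include hφ in
/-- The differential of `1 / W`, from `W² = g(∇u, ∇u) + 1 / φ` and
`v g(∇u, ∇u) = 2 g(∇_v ∇u, ∇u)`. -/
theorem hasFDerivAt_one_div_slopeFactor {u : M → ℝ} {x : M}
    (hg : DifferentiableAt ℝ (chartMetric g x) (extChartAt 𝓘(ℝ, E) x x))
    (hu : ∀ᶠ y in 𝓝 x, MDifferentiableAt 𝓘(ℝ, E) 𝓘(ℝ, ℝ) u y)
    (hu2 : DifferentiableAt ℝ (fderiv ℝ (u ∘ (extChartAt 𝓘(ℝ, E) x).symm))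
      (extChartAt 𝓘(ℝ, E) x x))
    (hφx : MDifferentiableAt 𝓘(ℝ, E) 𝓘(ℝ, ℝ) φ x) :
    ∃ D : E →L[ℝ] ℝ,
      HasFDerivAt ((fun y => 1 / slopeFactor g φ u y) ∘ (extChartAt 𝓘(ℝ, E) x).symm) D
        (extChartAt 𝓘(ℝ, E) x x) ∧
      ∀ v, D v = -(1 / slopeFactor g φ u x ^ 3) *
        (modelInner g x (modelCovDeriv g (gradient g u) x v) (modelGradient g u x) -
          modelDeriv φ x v / (2 * φ x ^ 2)) := by
  set z₀ := extChartAt 𝓘(ℝ, E) x x with hz₀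
  have hP := differentiableAt_chartField_gradient g hg hu hu2
  set P := chartField (gradient g u) x with hPdef
  have hφ' : DifferentiableAt ℝ (φ ∘ (extChartAt 𝓘(ℝ, E) x).symm) z₀ := by
    have h := hφx.differentiableWithinAt_writtenInExtChartAt
    rw [modelWithCornersSelf_coe, Set.range_id, differentiableWithinAt_univ] at h
    exact h
  have hφ0 : (φ ∘ (extChartAt 𝓘(ℝ, E) x).symm) z₀ = φ x := by
    rw [Function.comp_apply, hz₀, extChartAt_to_inv]
  have hS : HasFDerivAt (fun z => chartMetric g x z (P z) (P z) +
      1 / (φ ∘ (extChartAt 𝓘(ℝ, E) x).symm) z)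
      (fderiv ℝ (fun z => chartMetric g x z (P z) (P z)) z₀ +
        (-(φ x ^ 2)⁻¹) • fderiv ℝ (φ ∘ (extChartAt 𝓘(ℝ, E) x).symm) z₀) z₀ := by
    refine HasFDerivAt.add ((hg.clm_apply hP).clm_apply hP).hasFDerivAt ?_
    have h := (hasDerivAt_inv (hφ x).ne')
    rw [← hφ0] at h
    simpa only [one_div, Function.comp_def, hφ0] using h.comp_hasFDerivAt z₀ hφ'.hasFDerivAt
  have hself : chartMetric g x z₀ (P z₀) (P z₀) + 1 / (φ ∘ (extChartAt 𝓘(ℝ, E) x).symm) z₀ =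
      modelInner g x (modelGradient g u x) (modelGradient g u x) + 1 / φ x := by
    rw [hφ0, hPdef, hz₀, chartField_gradient_self, chartMetric_self]
  have hpos := slopeFactor_sq_pos g hφ u x
  have hW : slopeFactor g φ u x =
    Real.sqrt (modelInner g x (modelGradient g u x) (modelGradient g u x) + 1 / φ x) := rfl
  have hroot := (Real.hasDerivAt_sqrt hpos.ne').inv (Real.sqrt_pos.2 hpos).ne'
  rw [← hself] at hroot
  have hD := hroot.comp_hasFDerivAt z₀ hS
  rw [hself, ← hW] at hD
  refine ⟨_, hD.congr_of_eventuallyEq ?_, fun v => ?_⟩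
  · filter_upwards [extChartAt_target_mem_nhds (I := 𝓘(ℝ, E)) x] with z hz
    have h1 : chartMetric g x z (P z) (P z) = modelInner g ((extChartAt 𝓘(ℝ, E) x).symm z)
        (modelGradient g u ((extChartAt 𝓘(ℝ, E) x).symm z))
        (modelGradient g u ((extChartAt 𝓘(ℝ, E) x).symm z)) := by
      rw [chartMetric_apply, hPdef, symmDeriv_chartField _ _ hz]
      rfl
    simp only [Function.comp_apply, h1, Pi.inv_apply]
    exact one_div _
  · have hWpos : 0 < slopeFactor g φ u x := slopeFactor_pos g hφ u x
    have h2 := fderiv_chartMetric_apply g hg hP hP v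
    have h3 : P z₀ = modelGradient g u x := chartField_gradient_self _ _ _
    rw [← hz₀, h3] at h2
    have h4 : (fderiv ℝ P z₀ v + modelChristoffel g x v (modelGradient g u x)) =
      modelCovDeriv g (gradient g u) x v := by
      rw [modelCovDeriv_apply, chartField_gradient_self]
    rw [h4] at h2
    rw [modelDeriv_eq_fderiv hφx, ← hz₀]
    simp only [smul_apply, add_apply, h2, smul_eq_mul]
    have := (hφ x).ne'
    field_simp
    ring

include hφ in
theorem divergence_gradient_div_slopeFactor {u : M → ℝ} {x : M}
    (hg : DifferentiableAt ℝ (chartMetric g x) (extChartAt 𝓘(ℝ, E) x x))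
    (hu : ∀ᶠ y in 𝓝 x, MDifferentiableAt 𝓘(ℝ, E) 𝓘(ℝ, ℝ) u y)
    (hu2 : DifferentiableAt ℝ (fderiv ℝ (u ∘ (extChartAt 𝓘(ℝ, E) x).symm))
      (extChartAt 𝓘(ℝ, E) x x))
    (hφx : MDifferentiableAt 𝓘(ℝ, E) 𝓘(ℝ, ℝ) φ x) :
    divergence g (fun y => (1 / slopeFactor g φ u y) • gradient g u y) x =
      1 / slopeFactor g φ u x * divergence g (gradient g u) x -
        (1 / slopeFactor g φ u x ^ 3) *
          (modelInner g x (modelCovDeriv g (gradient g u) x (modelGradient g u x))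
              (modelGradient g u x) -
            modelDeriv φ x (modelGradient g u x) / (2 * φ x ^ 2)) := by
  obtain ⟨D, hD, hDv⟩ := hasFDerivAt_one_div_slopeFactor g hφ hg hu hu2 hφx
  rw [divergence_smul g hD.differentiableAt (differentiableAt_chartField_gradient g hg hu hu2),
    hD.fderiv, hDv, chartField_gradient_self]
  ring

end Divergence

/-! ### The warped product metric in a preferred chart -/

section WarpedChart

variable {E : Type*} [NormedAddCommGroup E] [NormedSpace ℝ E]
  {M : Type*} [TopologicalSpace M] [ChartedSpace E M]

theorem modelInner_warpedMetric (g : Bundle.RiemannianMetric (fun x : M => TangentSpace 𝓘(ℝ, E) x))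
    (φ : M → ℝ) (hφ : ∀ x, 0 < φ x) (p : M × ℝ) (a b : E × ℝ) :
    modelInner (warpedMetric g φ hφ) p a b =
      modelInner g p.1 a.1 b.1 + φ p.1 * (a.2 * b.2) := rfl

theorem mfderiv_extChartAt_prod_symm [IsManifold 𝓘(ℝ, E) 1 M] (p : M × ℝ) {z : E × ℝ}
    (hz : z.1 ∈ (extChartAt 𝓘(ℝ, E) p.1).target) (a : E × ℝ) :
    (mfderiv 𝓘(ℝ, E × ℝ) (𝓘(ℝ, E).prod 𝓘(ℝ, ℝ)) (extChartAt (𝓘(ℝ, E).prod 𝓘(ℝ, ℝ)) p).symm z :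
      E × ℝ →L[ℝ] E × ℝ) a = (symmDeriv p.1 z.1 a.1, a.2) := by
  have hz' : z ∈ (extChartAt (𝓘(ℝ, E).prod 𝓘(ℝ, ℝ)) p).target := by
    rw [extChartAt_prod]
    refine ⟨hz, ?_⟩
    rw [extChartAt_model_space_eq_id]
    trivial
  have hd : MDifferentiableAt 𝓘(ℝ, E × ℝ) (𝓘(ℝ, E).prod 𝓘(ℝ, ℝ))
      (extChartAt (𝓘(ℝ, E).prod 𝓘(ℝ, ℝ)) p).symm z := by
    have h := mdifferentiableWithinAt_extChartAt_symm (I := 𝓘(ℝ, E).prod 𝓘(ℝ, ℝ)) hz'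
    have hr : Set.range (𝓘(ℝ, E).prod 𝓘(ℝ, ℝ)) = Set.univ := by
      rw [ModelWithCorners.range_prod]; simp
    rwa [hr, mdifferentiableWithinAt_univ] at h
  have hd1 := mdifferentiableAt_extChartAt_symm' p.1 hz
  have hw := hd1.differentiableWithinAt_writtenInExtChartAt
  rw [modelWithCornersSelf_coe, Set.range_id, differentiableWithinAt_univ] at hw
  have h1 : symmDeriv p.1 z.1 = fderiv ℝ (writtenInExtChartAt 𝓘(ℝ, E) 𝓘(ℝ, E) z.1
      (extChartAt 𝓘(ℝ, E) p.1).symm) z.1 := by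
    rw [symmDeriv, hd1.mfderiv, modelWithCornersSelf_coe, Set.range_id, fderivWithin_univ]
    rfl
  rw [hd.mfderiv, modelWithCornersSelf_coe, Set.range_id, fderivWithin_univ, h1]
  have h2 : HasFDerivAt (writtenInExtChartAt 𝓘(ℝ, E × ℝ) (𝓘(ℝ, E).prod 𝓘(ℝ, ℝ)) z
      (extChartAt (𝓘(ℝ, E).prod 𝓘(ℝ, ℝ)) p).symm)
      ((fderiv ℝ (writtenInExtChartAt 𝓘(ℝ, E) 𝓘(ℝ, E) z.1
        (extChartAt 𝓘(ℝ, E) p.1).symm) z.1).prodMap (ContinuousLinearMap.id ℝ ℝ)) z :=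
    HasFDerivAt.prodMap z hw.hasFDerivAt (hasFDerivAt_id z.2)
  exact congrArg (fun f : E × ℝ →L[ℝ] E × ℝ => f a) h2.fderiv

theorem chartMetric_warpedMetric [IsManifold 𝓘(ℝ, E) 1 M]
    (g : Bundle.RiemannianMetric (fun x : M => TangentSpace 𝓘(ℝ, E) x))
    (φ : M → ℝ) (hφ : ∀ x, 0 < φ x) (p : M × ℝ) {z : E × ℝ}
    (hz : z.1 ∈ (extChartAt 𝓘(ℝ, E) p.1).target) (a b : E × ℝ) :
    chartMetric (warpedMetric g φ hφ) p z a b = chartMetric g p.1 z.1 a.1 b.1 +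
      φ ((extChartAt 𝓘(ℝ, E) p.1).symm z.1) * (a.2 * b.2) :=
  congrArg₂ (fun v w : E × ℝ => modelInner (warpedMetric g φ hφ)
      ((extChartAt (𝓘(ℝ, E).prod 𝓘(ℝ, ℝ)) p).symm z) v w)
    (mfderiv_extChartAt_prod_symm p hz a) (mfderiv_extChartAt_prod_symm p hz b)

variable [FiniteDimensional ℝ E] [IsManifold 𝓘(ℝ, E) ∞ M]

/-- The derivative of the warped product metric in a chart: that of `g` together with
`∂_c φ dr²`. -/
theorem chartMetricDeriv_warpedMetric
    (g : Bundle.ContMDiffRiemannianMetric 𝓘(ℝ, E) ∞ E (fun x : M => TangentSpace 𝓘(ℝ, E) x))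
    (φ : M → ℝ) (hφ : ∀ x, 0 < φ x) (hφs : ContMDiff 𝓘(ℝ, E) 𝓘(ℝ, ℝ) ∞ φ) (p : M × ℝ)
    (c a b : E × ℝ) :
    chartMetricDeriv (warpedMetric g.toRiemannianMetric φ hφ) p c a b =
      chartMetricDeriv g.toRiemannianMetric p.1 c.1 a.1 b.1 +
        modelDeriv φ p.1 c.1 * (a.2 * b.2) := by
  have : IsManifold 𝓘(ℝ, E) 1 M := IsManifold.of_le (n := ∞) (by simp)
  set T : Set (E × ℝ) := (extChartAt 𝓘(ℝ, E) p.1).target ×ˢ Set.univ with hT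
  set z₀ : E × ℝ := (extChartAt 𝓘(ℝ, E) p.1 p.1, p.2) with hz₀
  have hTn : T ∈ 𝓝 z₀ :=
    prod_mem_nhds (extChartAt_target_mem_nhds p.1) Filter.univ_mem
  have hg := contDiffOn_chartMetric g p.1
  have hφ' : ContDiffOn ℝ ∞ (φ ∘ (extChartAt 𝓘(ℝ, E) p.1).symm)
      (extChartAt 𝓘(ℝ, E) p.1).target :=
    (hφs.comp_contMDiffOn (contMDiffOn_extChartAt_symm p.1)).contDiffOn
  have hscal : ∀ a b : E × ℝ, ContDiffOn ℝ ∞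
      (fun z => chartMetric (warpedMetric g.toRiemannianMetric φ hφ) p z a b) T := fun a b => by
    have hfst : Set.MapsTo Prod.fst T (extChartAt 𝓘(ℝ, E) p.1).target := fun z hz => hz.1
    have h1 := hg.comp contDiff_fst.contDiffOn hfst
    have h2 := hφ'.comp contDiff_fst.contDiffOn hfst
    refine ContDiffOn.congr (((h1.clm_apply contDiffOn_const).clm_apply contDiffOn_const).add
      (h2.mul contDiffOn_const)) fun z hz => chartMetric_warpedMetric _ φ hφ p hz.1 a b
  have hW : DifferentiableAt ℝ (chartMetric (warpedMetric g.toRiemannianMetric φ hφ) p) z₀ :=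
    ((contDiffOn_clm_apply.2 fun a => contDiffOn_clm_apply.2 fun b =>
      hscal a b).contDiffAt hTn).differentiableAt (by simp)
  have hgd := (contDiffAt_chartMetric g p.1).differentiableAt (by simp)
  have hφd : DifferentiableAt ℝ (φ ∘ (extChartAt 𝓘(ℝ, E) p.1).symm)
      (extChartAt 𝓘(ℝ, E) p.1 p.1) :=
    (contDiffAt_comp_symm hφs.contMDiffAt).differentiableAt (by simp)
  have hL : HasFDerivAt (fun z => chartMetric (warpedMetric g.toRiemannianMetric φ hφ) p z a b)
      (((chartMetricDeriv (warpedMetric g.toRiemannianMetric φ hφ) p).flip a).flip b) z₀ := by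
    have h := (hW.hasFDerivAt.clm_apply (hasFDerivAt_const a z₀)).clm_apply (hasFDerivAt_const b z₀)
    refine h.congr_fderiv ?_
    ext c <;> simp [chartMetricDeriv, hz₀] <;> rfl
  have hgf : HasFDerivAt (fun z => chartMetric g.toRiemannianMetric p.1 z a.1 b.1)
      (((chartMetricDeriv g.toRiemannianMetric p.1).flip a.1).flip b.1)
      (extChartAt 𝓘(ℝ, E) p.1 p.1) := by
    have h := (hgd.hasFDerivAt.clm_apply (hasFDerivAt_const a.1 _)).clm_apply
      (hasFDerivAt_const b.1 _)
    refine h.congr_fderiv ?_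
    ext c
    simp [chartMetricDeriv]
  have hR : HasFDerivAt (fun z : E × ℝ => chartMetric g.toRiemannianMetric p.1 z.1 a.1 b.1 +
      (φ ∘ (extChartAt 𝓘(ℝ, E) p.1).symm) z.1 * (a.2 * b.2))
      ((((chartMetricDeriv g.toRiemannianMetric p.1).flip a.1).flip b.1).comp
        (ContinuousLinearMap.fst ℝ E ℝ) + (a.2 * b.2) • ((fderiv ℝ (φ ∘
          (extChartAt 𝓘(ℝ, E) p.1).symm) (extChartAt 𝓘(ℝ, E) p.1 p.1)).comp
            (ContinuousLinearMap.fst ℝ E ℝ))) z₀ := by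
    have hA : HasFDerivAt
        (fun z : E × ℝ => chartMetric g.toRiemannianMetric p.1 z.1 a.1 b.1) _ z₀ :=
      HasFDerivAt.comp (g := fun y => chartMetric g.toRiemannianMetric p.1 y a.1 b.1)
        (f := Prod.fst) z₀ hgf (hasFDerivAt_fst (p := z₀))
    have hB : HasFDerivAt (fun z : E × ℝ => (φ ∘ (extChartAt 𝓘(ℝ, E) p.1).symm) z.1) _ z₀ :=
      HasFDerivAt.comp (g := φ ∘ (extChartAt 𝓘(ℝ, E) p.1).symm) (f := Prod.fst) z₀
        hφd.hasFDerivAt (hasFDerivAt_fst (p := z₀))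
    exact hA.fun_add (hB.mul_const _)
  have heq : (fun z => chartMetric (warpedMetric g.toRiemannianMetric φ hφ) p z a b) =ᶠ[𝓝 z₀]
      fun z => chartMetric g.toRiemannianMetric p.1 z.1 a.1 b.1 +
        (φ ∘ (extChartAt 𝓘(ℝ, E) p.1).symm) z.1 * (a.2 * b.2) := by
    filter_upwards [hTn] with z hz
    exact chartMetric_warpedMetric _ φ hφ p hz.1 a b
  have h := congrArg (fun f : E × ℝ →L[ℝ] ℝ => f c) ((hL.congr_of_eventuallyEq heq.symm).unique hR)
  rw [modelDeriv_eq_fderiv (hφs.mdifferentiableAt (by simp))]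
  refine h.trans ?_
  simp only [add_apply, smul_apply, smul_eq_mul, ContinuousLinearMap.comp_apply,
    ContinuousLinearMap.flip_apply, ContinuousLinearMap.coe_fst']
  ring

end WarpedChart

/-! ### Derivatives of the graph map and of the translations -/

section Graph

variable {E : Type*} [NormedAddCommGroup E] [NormedSpace ℝ E]
  {M : Type*} [TopologicalSpace M] [ChartedSpace E M]

theorem mfderiv_graphMap {u : M → ℝ} {x : M} (hu : MDifferentiableAt 𝓘(ℝ, E) 𝓘(ℝ, ℝ) u x) (v : E) :
    (mfderiv 𝓘(ℝ, E) (𝓘(ℝ, E).prod 𝓘(ℝ, ℝ)) (graphMap u) x : E →L[ℝ] E × ℝ) v =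
      (v, modelDeriv u x v) := by
  have h := (hasMFDerivAt_id x).prodMk hu.hasMFDerivAt (I := 𝓘(ℝ, E))
  exact congrArg (fun f : E →L[ℝ] E × ℝ => f v) h.mfderiv

theorem generator_translation (p : M × ℝ) :
    (generator (𝓘(ℝ, E).prod 𝓘(ℝ, ℝ)) translation p : E × ℝ) = (0, 1) := by
  have h1 : HasMFDerivAt 𝓘(ℝ, ℝ) 𝓘(ℝ, ℝ) (fun t : ℝ => p.2 + t) 0 (ContinuousLinearMap.id ℝ ℝ) :=
    ((hasFDerivAt_id (0 : ℝ)).const_add p.2).hasMFDerivAt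
  have h := (hasMFDerivAt_const (I := 𝓘(ℝ, ℝ)) (I' := 𝓘(ℝ, E)) p.1 (0 : ℝ)).prodMk h1
  exact congrArg (fun f : ℝ →L[ℝ] E × ℝ => f 1) h.mfderiv

theorem fderiv_fderiv_graphMap {u : M → ℝ} {x : M}
    (hu : ContDiffAt ℝ ∞ (u ∘ (extChartAt 𝓘(ℝ, E) x).symm) (extChartAt 𝓘(ℝ, E) x x)) (v w : E) :
    (fderiv ℝ (fderiv ℝ (writtenInExtChartAt 𝓘(ℝ, E) (𝓘(ℝ, E).prod 𝓘(ℝ, ℝ)) x (graphMap u)))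
      (extChartAt 𝓘(ℝ, E) x x) v w : E × ℝ) =
      (0, fderiv ℝ (fderiv ℝ (u ∘ (extChartAt 𝓘(ℝ, E) x).symm)) (extChartAt 𝓘(ℝ, E) x x) v w) := by
  set z₀ := extChartAt 𝓘(ℝ, E) x x
  set U := u ∘ (extChartAt 𝓘(ℝ, E) x).symm
  have h1 : (writtenInExtChartAt 𝓘(ℝ, E) (𝓘(ℝ, E).prod 𝓘(ℝ, ℝ)) x (graphMap u) : E → E × ℝ)
      =ᶠ[𝓝 z₀] fun z => (z, U z) := by
    filter_upwards [extChartAt_target_mem_nhds (I := 𝓘(ℝ, E)) x] with z hz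
    exact Prod.ext ((extChartAt 𝓘(ℝ, E) x).right_inv hz) rfl
  have hd : ∀ᶠ z in 𝓝 z₀, DifferentiableAt ℝ U z :=
    ((hu.of_le (show (1 : WithTop ℕ∞) ≤ ∞ by simp)).eventually (by decide)).mono
      fun z hz => hz.differentiableAt one_ne_zero
  have h2 : fderiv ℝ (fun z => (z, U z)) =ᶠ[𝓝 z₀] fun z =>
      ContinuousLinearMap.inl ℝ E ℝ + (ContinuousLinearMap.inr ℝ E ℝ).comp (fderiv ℝ U z) := by
    filter_upwards [hd] with z hz
    refine ((hasFDerivAt_id z).prodMk hz.hasFDerivAt).fderiv.trans ?_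
    ext a <;> simp
  have h3 : DifferentiableAt ℝ (fderiv ℝ U) z₀ :=
    (hu.fderiv_right (m := 1) (by decide)).differentiableAt one_ne_zero
  have h4 : HasFDerivAt (fun z => ContinuousLinearMap.inl ℝ E ℝ +
      (ContinuousLinearMap.inr ℝ E ℝ).comp (fderiv ℝ U z))
      ((ContinuousLinearMap.compL ℝ E ℝ (E × ℝ) (ContinuousLinearMap.inr ℝ E ℝ)).comp
        (fderiv ℝ (fderiv ℝ U) z₀)) z₀ :=
    ((ContinuousLinearMap.compL ℝ E ℝ (E × ℝ)
      (ContinuousLinearMap.inr ℝ E ℝ)).hasFDerivAt.comp z₀ h3.hasFDerivAt).const_add _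
  have h5 := (h1.fderiv.trans h2).fderiv_eq (𝕜 := ℝ)
  rw [h4.fderiv] at h5
  exact congrArg (fun f : E →L[ℝ] E →L[ℝ] E × ℝ => f v w) h5

end Graph

/-! ### The normal component of the mean curvature vector -/

section Immersion

variable {E : Type*} [NormedAddCommGroup E] [NormedSpace ℝ E] [FiniteDimensional ℝ E]
  {H : Type*} [TopologicalSpace H] {I : ModelWithCorners ℝ E H}
  {S : Type*} [TopologicalSpace S] [ChartedSpace H S]
  {E' : Type*} [NormedAddCommGroup E'] [NormedSpace ℝ E'] [FiniteDimensional ℝ E']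
  {H' : Type*} [TopologicalSpace H'] {J : ModelWithCorners ℝ E' H'}
  {N : Type*} [TopologicalSpace N] [ChartedSpace H' N]
  (g : Bundle.RiemannianMetric (fun p : N => TangentSpace J p)) (F : S → N) (x : S)

omit [FiniteDimensional ℝ E'] in
theorem inner_normalPart {ν : TangentSpace J (F x)} (hν : IsUnitNormal I g F x ν)
    (w : TangentSpace J (F x)) :
    g.inner (F x) (normalPart I g F x w) ν = g.inner (F x) w ν := by
  have h : ∀ i, g.inner (F x) (pushBasis I J F x i) ν = 0 := fun i => hν.2 _
  simp only [normalPart, map_sub, map_sum, map_smul, sub_apply,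
    sum_apply, smul_apply, h, smul_zero,
    Finset.sum_const_zero, sub_zero]

theorem inner_meanCurvatureVector {ν : TangentSpace J (F x)} (hν : IsUnitNormal I g F x ν) :
    g.inner (F x) (meanCurvatureVector I g F x) ν =
      ∑ i, ∑ j, (inducedMatrix I g F x)⁻¹ i j *
        g.inner (F x) (covDerivAlong I g F x (Module.finBasis ℝ E i : E)
          (Module.finBasis ℝ E j : E)) ν := by
  simp only [meanCurvatureVector, map_sum, map_smul, sum_apply, smul_apply, smul_eq_mul]
  exact Finset.sum_congr rfl fun i _ => Finset.sum_congr rfl fun j _ =>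
    congrArg _ (inner_normalPart g F x hν _)

end Immersion

/-! ### The mean curvature of a graph -/

section GraphCurvature

variable {E : Type*} [NormedAddCommGroup E] [NormedSpace ℝ E] [FiniteDimensional ℝ E]
  {M : Type*} [TopologicalSpace M] [ChartedSpace E M]

/-- The unit normals of the graph are the two vectors `ν = (-φ ν₂ ∇u, ν₂)` with `φ² ν₂² W² = 1`. -/
theorem isUnitNormal_graphMap_iff
    (g : Bundle.RiemannianMetric (fun x : M => TangentSpace 𝓘(ℝ, E) x))
    (φ : M → ℝ) (hφ : ∀ x, 0 < φ x) {u : M → ℝ} {x : M}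
    (hu : MDifferentiableAt 𝓘(ℝ, E) 𝓘(ℝ, ℝ) u x) (ν : E × ℝ) :
    IsUnitNormal 𝓘(ℝ, E) (warpedMetric g φ hφ) (graphMap u) x ν ↔
      ν.1 = -(φ x * ν.2) • modelGradient g u x ∧
        φ x ^ 2 * ν.2 ^ 2 *
          (modelInner g x (modelGradient g u x) (modelGradient g u x) + 1 / φ x) = 1 := by
  have hx := (hφ x).ne'
  have h1 : ∀ v : E, (warpedMetric g φ hφ).inner (graphMap u x)
      (mfderiv 𝓘(ℝ, E) (𝓘(ℝ, E).prod 𝓘(ℝ, ℝ)) (graphMap u) x v) ν =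
      modelInner g x (ν.1 + (φ x * ν.2) • modelGradient g u x) v := fun v => by
    refine (congrArg (fun a : E × ℝ => modelInner (warpedMetric g φ hφ) (graphMap u x) a ν)
      (mfderiv_graphMap hu v)).trans ?_
    rw [modelInner_warpedMetric, map_add, add_apply, map_smul, smul_apply, modelInner_gradient,
      modelInner_symm g x ν.1, smul_eq_mul]
    simp only [graphMap]
    ring
  have h2 : (warpedMetric g φ hφ).inner (graphMap u x) ν ν =
      modelInner g x ν.1 ν.1 + φ x * (ν.2 * ν.2) := rfl
  have h3 : ν.1 = -(φ x * ν.2) • modelGradient g u x →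
      modelInner g x ν.1 ν.1 + φ x * (ν.2 * ν.2) = φ x ^ 2 * ν.2 ^ 2 *
          (modelInner g x (modelGradient g u x) (modelGradient g u x) + 1 / φ x) := fun h => by
    rw [h]
    simp only [map_smul, smul_apply, smul_eq_mul]
    field_simp
  constructor
  · rintro ⟨hn, ho⟩
    have h4 : ν.1 = -(φ x * ν.2) • modelGradient g u x := by
      by_contra h
      have h5 : ν.1 + (φ x * ν.2) • modelGradient g u x ≠ 0 := fun h0 => h (by
        rw [eq_neg_of_add_eq_zero_left h0, neg_smul])
      exact (modelInner_pos g x h5).ne' ((h1 _).symm.trans (ho _))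
    exact ⟨h4, (h3 h4).symm.trans (h2.symm.trans hn)⟩
  · rintro ⟨h4, h5⟩
    refine ⟨h2.trans ((h3 h4).trans h5), fun v => (h1 v).trans ?_⟩
    have h6 : modelInner g x (ν.1 + (φ x * ν.2) • modelGradient g u x) = 0 := by
      rw [h4, neg_smul, neg_add_cancel, map_zero]
    exact congrArg (fun f : E →L[ℝ] ℝ => f v) h6

variable [IsManifold 𝓘(ℝ, E) ∞ M]

omit [FiniteDimensional ℝ E] in
theorem eventually_mdifferentiableAt {u : M → ℝ} {x : M}
    (hu : ContMDiffAt 𝓘(ℝ, E) 𝓘(ℝ, ℝ) ∞ u x) :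
    ∀ᶠ y in 𝓝 x, MDifferentiableAt 𝓘(ℝ, E) 𝓘(ℝ, ℝ) u y := by
  have : IsManifold 𝓘(ℝ, E) 1 M := IsManifold.of_le (n := ∞) (by simp)
  exact ((contMDiffAt_iff_contMDiffAt_nhds (by decide)).1
    (hu.of_le (show (1 : WithTop ℕ∞) ≤ ∞ by simp))).mono
    fun y hy => hy.mdifferentiableAt one_ne_zero

omit [FiniteDimensional ℝ E] in
theorem differentiableAt_fderiv_comp_symm {u : M → ℝ} {x : M}
    (hu : ContMDiffAt 𝓘(ℝ, E) 𝓘(ℝ, ℝ) ∞ u x) :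
    DifferentiableAt ℝ (fderiv ℝ (u ∘ (extChartAt 𝓘(ℝ, E) x).symm)) (extChartAt 𝓘(ℝ, E) x x) :=
  ((contDiffAt_comp_symm hu).fderiv_right (m := 1) (by decide)).differentiableAt one_ne_zero

/-- The second fundamental form of the graph against a normal `ν`. The Christoffel symbols of the
warped product contribute those of `g`, which turn `D²u` into the Hessian, and terms in `dφ`. -/
theorem inner_covDerivAlong_graphMap
    (g : Bundle.ContMDiffRiemannianMetric 𝓘(ℝ, E) ∞ E (fun x : M => TangentSpace 𝓘(ℝ, E) x))
    (φ : M → ℝ) (hφ : ∀ x, 0 < φ x) (hφs : ContMDiff 𝓘(ℝ, E) 𝓘(ℝ, ℝ) ∞ φ) {u : M → ℝ} {x : M}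
    (hu : ContMDiffAt 𝓘(ℝ, E) 𝓘(ℝ, ℝ) ∞ u x)
    {ν : E × ℝ} (hν : ν.1 = -(φ x * ν.2) • modelGradient g.toRiemannianMetric u x) (v w : E) :
    modelInner (warpedMetric g.toRiemannianMetric φ hφ) (graphMap u x)
      (covDerivAlong 𝓘(ℝ, E) (warpedMetric g.toRiemannianMetric φ hφ) (graphMap u) x v w) ν =
      φ x * ν.2 * (modelInner g.toRiemannianMetric x
          (modelCovDeriv g.toRiemannianMetric (gradient g.toRiemannianMetric u) x v) w +
        (modelDeriv φ x v * modelDeriv u x w + modelDeriv φ x w * modelDeriv u x v) / (2 * φ x) +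
        modelDeriv φ x (modelGradient g.toRiemannianMetric u x) *
          (modelDeriv u x v * modelDeriv u x w) / 2) := by
  have : IsManifold 𝓘(ℝ, E) 1 M := IsManifold.of_le (n := ∞) (by simp)
  have hx := (hφ x).ne'
  have hud : MDifferentiableAt 𝓘(ℝ, E) 𝓘(ℝ, ℝ) u x := hu.mdifferentiableAt (by simp)
  have hU := contDiffAt_comp_symm hu
  have hue : ∀ᶠ y in 𝓝 x, MDifferentiableAt 𝓘(ℝ, E) 𝓘(ℝ, ℝ) u y :=
    eventually_mdifferentiableAt hu
  have hu2 : DifferentiableAt ℝ (fderiv ℝ (u ∘ (extChartAt 𝓘(ℝ, E) x).symm))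
      (extChartAt 𝓘(ℝ, E) x x) := differentiableAt_fderiv_comp_symm hu
  have hg := (contDiffAt_chartMetric g x).differentiableAt (by simp)
  have hΓ := modelInner_christoffel g.toRiemannianMetric x v w ν.1
  set Γ := modelChristoffel g.toRiemannianMetric x v w
  set X := modelGradient g.toRiemannianMetric u x with hX
  have hadd : ∀ a b : E × ℝ, modelInner (warpedMetric g.toRiemannianMetric φ hφ) (graphMap u x)
      (a + b) ν = modelInner (warpedMetric g.toRiemannianMetric φ hφ) (graphMap u x) a ν +
        modelInner (warpedMetric g.toRiemannianMetric φ hφ) (graphMap u x) b ν := fun a b => by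
    rw [map_add, add_apply]
  have h0 : (covDerivAlong 𝓘(ℝ, E) (warpedMetric g.toRiemannianMetric φ hφ) (graphMap u) x v w :
      E × ℝ) = (0, fderiv ℝ (fderiv ℝ (u ∘ (extChartAt 𝓘(ℝ, E) x).symm))
        (extChartAt 𝓘(ℝ, E) x x) v w) +
      modelChristoffel (warpedMetric g.toRiemannianMetric φ hφ) (graphMap u x)
        (v, modelDeriv u x v) (w, modelDeriv u x w) :=
    congrArg₂ (fun a b : E × ℝ => a + b) (fderiv_fderiv_graphMap hU v w)
      (congrArg₂ (fun a b : E × ℝ => modelChristoffel (warpedMetric g.toRiemannianMetric φ hφ)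
        (graphMap u x) a b) (mfderiv_graphMap hud v) (mfderiv_graphMap hud w))
  refine (congrArg (fun a : E × ℝ => modelInner (warpedMetric g.toRiemannianMetric φ hφ)
    (graphMap u x) a ν) h0).trans ((hadd _ _).trans ?_)
  have hx1 : (graphMap u x).1 = x := rfl
  rw [modelInner_christoffel, chartMetricDeriv_warpedMetric g φ hφ hφs,
    chartMetricDeriv_warpedMetric g φ hφ hφs, chartMetricDeriv_warpedMetric g φ hφ hφs,
    modelInner_warpedMetric, inner_covDeriv_gradient _ hg hue hu2]
  simp only [hx1, map_zero, zero_apply]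
  have h2 : modelInner g.toRiemannianMetric x Γ ν.1 =
      -(φ x * ν.2) * modelInner g.toRiemannianMetric x Γ X := by
    rw [hν, map_smul, smul_eq_mul]
  have h3 : modelDeriv φ x ν.1 = -(φ x * ν.2) * modelDeriv φ x X := by
    rw [hν, map_smul, smul_eq_mul]
  rw [h2] at hΓ
  rw [h3, ← hX]
  field_simp
  linear_combination -2 * hΓ

/-- The mean curvature of the graph against a unit normal, in divergence form. -/
theorem inner_meanCurvatureVector_graphMap
    (g : Bundle.ContMDiffRiemannianMetric 𝓘(ℝ, E) ∞ E (fun x : M => TangentSpace 𝓘(ℝ, E) x))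
    (φ : M → ℝ) (hφ : ∀ x, 0 < φ x) (hφs : ContMDiff 𝓘(ℝ, E) 𝓘(ℝ, ℝ) ∞ φ) {u : M → ℝ} {x : M}
    (hu : ContMDiffAt 𝓘(ℝ, E) 𝓘(ℝ, ℝ) ∞ u x) {ν : E × ℝ}
    (hν : IsUnitNormal 𝓘(ℝ, E) (warpedMetric g.toRiemannianMetric φ hφ) (graphMap u) x ν) :
    modelInner (warpedMetric g.toRiemannianMetric φ hφ) (graphMap u x)
      (meanCurvatureVector 𝓘(ℝ, E) (warpedMetric g.toRiemannianMetric φ hφ) (graphMap u) x) ν =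
      φ x * ν.2 * (slopeFactor g.toRiemannianMetric φ u x *
          divergence g.toRiemannianMetric (fun y =>
            (1 / slopeFactor g.toRiemannianMetric φ u y) • gradient g.toRiemannianMetric u y) x +
        modelDeriv φ x (modelGradient g.toRiemannianMetric u x) / (2 * φ x)) := by
  have : IsManifold 𝓘(ℝ, E) 1 M := IsManifold.of_le (n := ∞) (by simp)
  have hx := hφ x
  have hud : MDifferentiableAt 𝓘(ℝ, E) 𝓘(ℝ, ℝ) u x := hu.mdifferentiableAt (by simp)
  have hue : ∀ᶠ y in 𝓝 x, MDifferentiableAt 𝓘(ℝ, E) 𝓘(ℝ, ℝ) u y :=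
    eventually_mdifferentiableAt hu
  have hu2 : DifferentiableAt ℝ (fderiv ℝ (u ∘ (extChartAt 𝓘(ℝ, E) x).symm))
      (extChartAt 𝓘(ℝ, E) x x) := differentiableAt_fderiv_comp_symm hu
  have hg := (contDiffAt_chartMetric g x).differentiableAt (by simp)
  have hν1 := ((isUnitNormal_graphMap_iff g.toRiemannianMetric φ hφ hud ν).1 hν).1
  have hgram : inducedMatrix 𝓘(ℝ, E) (warpedMetric g.toRiemannianMetric φ hφ) (graphMap u) x =
      Matrix.of fun i j => modelInner g.toRiemannianMetric x (Module.finBasis ℝ E i)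
        (Module.finBasis ℝ E j) + φ x * (modelDeriv u x (Module.finBasis ℝ E i) *
          modelDeriv u x (Module.finBasis ℝ E j)) := by
    ext i j
    exact congrArg₂ (fun a b : E × ℝ => modelInner (warpedMetric g.toRiemannianMetric φ hφ)
      (graphMap u x) a b) (mfderiv_graphMap hud _) (mfderiv_graphMap hud _)
  have hWpos := slopeFactor_pos g.toRiemannianMetric hφ u x
  have hWsq := slopeFactor_sq g.toRiemannianMetric hφ u x
  have htr := trace_graph_second_form (Module.finBasis ℝ E)
    (modelInner g.toRiemannianMetric x).toBilinForm
    (modelInner_symm g.toRiemannianMetric x)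
    (fun v hv => modelInner_pos g.toRiemannianMetric x hv) (φ x) hx
    (modelDeriv u x).toLinearMap (modelDeriv φ x).toLinearMap
    (modelGradient g.toRiemannianMetric u x) (modelGradient g.toRiemannianMetric φ x)
    (modelInner_gradient g.toRiemannianMetric u x) (modelInner_gradient g.toRiemannianMetric φ x)
    (modelCovDeriv g.toRiemannianMetric (gradient g.toRiemannianMetric u) x)
  have hsum := inner_meanCurvatureVector (warpedMetric g.toRiemannianMetric φ hφ) (graphMap u) x hν
  rw [hgram] at hsum
  refine hsum.trans ((Finset.sum_congr rfl fun i _ => Finset.sum_congr rfl fun j _ =>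
    congrArg _ (inner_covDerivAlong_graphMap g φ hφ hφs hu hν1 _ _)).trans ?_)
  simp only [mul_left_comm _ (φ x * ν.2), ← Finset.mul_sum]
  refine congrArg _ (htr.trans ?_)
  rw [divergence_gradient_div_slopeFactor g.toRiemannianMetric hφ hg hue hu2
    (hφs.mdifferentiableAt (by simp)), divergence_eq_trace]
  set W := slopeFactor g.toRiemannianMetric φ u x
  set X := modelGradient g.toRiemannianMetric u x
  set L := modelCovDeriv g.toRiemannianMetric (gradient g.toRiemannianMetric u) x
  refine Eq.trans (b := LinearMap.trace ℝ E L - modelInner g.toRiemannianMetric x (L X) X / W ^ 2 +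
    modelDeriv φ x X / (2 * φ x ^ 2 * W ^ 2) + modelDeriv φ x X / (2 * φ x)) ?_ ?_
  · rw [hWsq]
    rfl
  · field_simp
    ring

/-- The soliton equation at a point for one unit normal `ν`: as `g(K, ν) = φ ν₂`, it is the
equation in divergence form multiplied by the non-zero factor `φ ν₂ W`. -/
theorem inner_meanCurvatureVector_eq_generator_iff
    (g : Bundle.ContMDiffRiemannianMetric 𝓘(ℝ, E) ∞ E (fun x : M => TangentSpace 𝓘(ℝ, E) x))
    (φ : M → ℝ) (hφ : ∀ x, 0 < φ x) (hφs : ContMDiff 𝓘(ℝ, E) 𝓘(ℝ, ℝ) ∞ φ) {u : M → ℝ} {x : M}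
    (hu : ContMDiffAt 𝓘(ℝ, E) 𝓘(ℝ, ℝ) ∞ u x) {ν : E × ℝ}
    (hν : IsUnitNormal 𝓘(ℝ, E) (warpedMetric g.toRiemannianMetric φ hφ) (graphMap u) x ν) :
    modelInner (warpedMetric g.toRiemannianMetric φ hφ) (graphMap u x)
        (meanCurvatureVector 𝓘(ℝ, E) (warpedMetric g.toRiemannianMetric φ hφ) (graphMap u) x) ν =
      modelInner (warpedMetric g.toRiemannianMetric φ hφ) (graphMap u x)
        (generator (𝓘(ℝ, E).prod 𝓘(ℝ, ℝ)) translation (graphMap u x)) ν ↔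
      divergence g.toRiemannianMetric (fun y =>
          (1 / slopeFactor g.toRiemannianMetric φ u y) • gradient g.toRiemannianMetric u y) x =
        1 / slopeFactor g.toRiemannianMetric φ u x -
          1 / (2 * slopeFactor g.toRiemannianMetric φ u x * φ x) *
            modelInner g.toRiemannianMetric x (modelGradient g.toRiemannianMetric φ x)
              (modelGradient g.toRiemannianMetric u x) := by
  have hW := slopeFactor_pos g.toRiemannianMetric hφ u x
  have hφx := hφ x
  have hK : modelInner (warpedMetric g.toRiemannianMetric φ hφ)
        (graphMap u x)
        (generator (𝓘(ℝ, E).prod 𝓘(ℝ, ℝ)) translation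
          (graphMap u x)) ν = φ x * ν.2 := by
    refine (congrArg (fun a : E × ℝ => modelInner
      (warpedMetric g.toRiemannianMetric φ hφ) (graphMap u x) a ν)
      (generator_translation _)).trans ?_
    rw [modelInner_warpedMetric, map_zero, zero_apply, zero_add, one_mul]
    rfl
  have hν2 : φ x * ν.2 ≠ 0 := fun h => by
    have h1 := ((isUnitNormal_graphMap_iff g.toRiemannianMetric φ hφ
      (hu.mdifferentiableAt (by simp)) ν).1 hν).2
    rw [← mul_pow, h] at h1
    norm_num at h1
  rw [hK, inner_meanCurvatureVector_graphMap g φ hφ hφs hu hν, mul_eq_left₀ hν2,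
    modelInner_gradient]
  constructor
  · intro h
    field_simp at h ⊢
    linear_combination h
  · intro h
    rw [h]
    field_simp
    ring

end GraphCurvature

end KillingGraph

end

theorem mainTheorem2 {E : Type*} [NormedAddCommGroup E] [NormedSpace ℝ E] [FiniteDimensional ℝ E]
    {M : Type*} [TopologicalSpace M] [ChartedSpace E M] [IsManifold 𝓘(ℝ, E) ∞ M]
    (g : Bundle.ContMDiffRiemannianMetric 𝓘(ℝ, E) ∞ E (fun x : M => TangentSpace 𝓘(ℝ, E) x))
    (φ : M → ℝ) (hφ : ∀ x, 0 < φ x) (hφs : ContMDiff 𝓘(ℝ, E) 𝓘(ℝ, ℝ) ∞ φ)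
    (I : Set ℝ) (hI : I.OrdConnected)
    (Ω : Set M) (hΩ : IsOpen Ω) (u : M → ℝ) (huI : Set.MapsTo u Ω I)
    (hu : ContMDiffOn 𝓘(ℝ, E) 𝓘(ℝ, ℝ) ∞ u Ω) :
    KillingGraph.IsSoliton 𝓘(ℝ, E)
        (KillingGraph.warpedMetric g.toRiemannianMetric φ hφ)
        KillingGraph.translation (KillingGraph.cylinder M I) (KillingGraph.graphMap u) Ω ↔
      ∀ x ∈ Ω,
        KillingGraph.divergence g.toRiemannianMetric
            (fun y => (1 / KillingGraph.slopeFactor g.toRiemannianMetric φ u y) •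
              KillingGraph.gradient g.toRiemannianMetric u y) x =
          1 / KillingGraph.slopeFactor g.toRiemannianMetric φ u x -
            1 / (2 * KillingGraph.slopeFactor g.toRiemannianMetric φ u x * φ x) *
              g.inner x (KillingGraph.gradient g.toRiemannianMetric φ x)
                (KillingGraph.gradient g.toRiemannianMetric u x) := by
  constructor
  · intro h x hx
    have hW := KillingGraph.slopeFactor_pos g.toRiemannianMetric hφ u x
    have hux := hu.contMDiffAt (hΩ.mem_nhds hx)
    -- the upward unit normal `ν = (-∇u / W, 1 / (φ W))`
    set ν₂ : ℝ := 1 / (φ x * KillingGraph.slopeFactor g.toRiemannianMetric φ u x) with hν₂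
    let ν : E × ℝ := (-(φ x * ν₂) • KillingGraph.modelGradient g.toRiemannianMetric u x, ν₂)
    have hν := (KillingGraph.isUnitNormal_graphMap_iff g.toRiemannianMetric φ hφ
      (hux.mdifferentiableAt (by simp)) ν).2 ⟨rfl, by
        have hφx := hφ x
        rw [← KillingGraph.slopeFactor_sq g.toRiemannianMetric hφ u x]
        simp only [ν, hν₂]
        field_simp⟩
    exact (KillingGraph.inner_meanCurvatureVector_eq_generator_iff g φ hφ hφs hux hν).1
      (h.equation x hx ν hν)
  · intro h
    refine ⟨fun x hx => ⟨trivial, huI hx⟩, contMDiffOn_id.prodMk hu, fun x hx v w hvw => ?_,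
      fun x hx ν hν => (KillingGraph.inner_meanCurvatureVector_eq_generator_iff g φ hφ hφs
        (hu.contMDiffAt (hΩ.mem_nhds hx)) hν).2 (h x hx)⟩
    have hud := (hu.contMDiffAt (hΩ.mem_nhds hx)).mdifferentiableAt (by simp)
    exact congrArg Prod.fst ((KillingGraph.mfderiv_graphMap hud v).symm.trans
      (Eq.trans hvw (KillingGraph.mfderiv_graphMap hud w)))
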